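/- **Theorem.** There exists a continuous, piecewise affine map $T:[0,1]^2\to[0,1]^2$ such that $$h_{\mathrm{top}}(T)=\sup_{\mu} h(T,\mu)=\log 2,$$ where the supremum is over all $T$-invariant Borel probability measures $\mu$ on $[0,1]^2$, but such that no $T$-invariant Borel probability measure $\mu$ attains it, i.e. $T$ has no measure of maximal entropy. Here $T$ is called piecewise affine if $[0,1]^2$ has a finite partition into convex sets on each of which $T$ coincides with an affine map of $\mathbb R^2$; $h_{\mathrm{top}}(T)$ is the topological entropy of $T$ and $h(T,\mu)$ its Kolmogorov–Sinai entropy with respect to $\mu$, both with natural logarithms. -/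

import Mathlib

open MeasureTheory Filter

noncomputable section

/-- The square `[0,1]²` in the plane. -/
abbrev unitSquare : Set (ℝ × ℝ) := Set.Icc (0 : ℝ) 1 ×ˢ Set.Icc (0 : ℝ) 1

/-- A self-map of the square is piecewise affine if the square has a finite partition into convex
sets such that the map coincides on each piece with an affine map of the plane. (A finite
triangulation gives such a partition, namely into its open triangles, open edges and vertices.) -/
def IsPiecewiseAffine (T : unitSquare → unitSquare) : Prop :=
  ∃ P : Set (Set (ℝ × ℝ)), P.Finite ∧ P.PairwiseDisjoint id ∧ ⋃₀ P = unitSquare ∧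
    ∀ A ∈ P, Convex ℝ A ∧
      ∃ L : (ℝ × ℝ) →ᵃ[ℝ] (ℝ × ℝ), ∀ x : unitSquare, (x : ℝ × ℝ) ∈ A → (T x : ℝ × ℝ) = L x

/-- The topological entropy of a self-map of a (compact) uniform space, in Bowen's form: the
supremum over the entourages of the exponential growth rate of minimal dynamical covers. -/
def topologicalEntropy {X : Type*} [UniformSpace X] (T : X → X) : EReal :=
  Dynamics.coverEntropy T Set.univ

section Metric

variable {X : Type*} [MeasurableSpace X]

/-- The Shannon entropy (natural logarithm) of the finite partition of `X` into the fibres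
of `ξ`. -/
def partitionEntropy {ι : Type*} [Fintype ι] (μ : Measure X) (ξ : X → ι) : ℝ :=
  ∑ i, Real.negMulLog (μ.real (ξ ⁻¹' {i}))

/-- The map whose fibres are the elements of the joined partition `⋁_{i < n} T⁻ⁱ ξ`. -/
def joinedPartition {ι : Type*} (T : X → X) (ξ : X → ι) (n : ℕ) : X → (Fin n → ι) :=
  fun x i => ξ (T^[(i : ℕ)] x)

/-- The entropy `h(T, μ, ξ)` of `T` with respect to the partition `ξ`. For invariant `μ` the
upper limit is a limit. -/
def entropyOfPartition {ι : Type*} [Fintype ι] (T : X → X) (μ : Measure X) (ξ : X → ι) : EReal :=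
  limsup (fun n : ℕ => ((partitionEntropy μ (joinedPartition T ξ n) / n : ℝ) : EReal)) atTop

/-- The Kolmogorov–Sinai entropy `h(T, μ)`: the supremum of `h(T, μ, ξ)` over all finite
measurable partitions `ξ`. -/
def metricEntropy (T : X → X) (μ : Measure X) : EReal :=
  ⨆ (k : ℕ) (ξ : X → Fin k) (_ : Measurable ξ), entropyOfPartition T μ ξ

/-- `μ` is a `T`-invariant probability measure. -/
def IsInvariantProbability (T : X → X) (μ : Measure X) : Prop :=
  IsProbabilityMeasure μ ∧ MeasurePreserving T μ μ

/-- `μ` is a measure of maximal entropy of `T`: an invariant probability measure with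
`h(T, μ) = h_top(T)`. -/
def IsMaximalEntropyMeasure [UniformSpace X] (T : X → X) (μ : Measure X) : Prop :=
  IsInvariantProbability T μ ∧ metricEntropy T μ = topologicalEntropy T

end Metric

end

noncomputable section

open scoped Topology Uniformity symmDiff

/-! ### The map -/

/-! Near the origin the map acts on rays `x = θ y` by a folding map whose two full branches, on `θ ≤
1/5` and `4/5 ≤ θ ≤ 1`, have slopes `5` and `-5`. The first halves the height and the second doubles
it, up to truncation at height `1`. On points coded by a level `k` (height `2⁻ᵏ`) and a digit
sequence, the map is the shift on digits driving a reflected walk on levels. The other orbits fall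
onto the axis `x = 0`, where only digit `0` occurs. Digits can have entropy up to `log 2`, but for
fair independent digits the walk is null recurrent: it has no stationary probability, and mass
escapes to the fixed point at the origin.

Upper bounds: the digits determine the grid name of length `n` up to polynomially many possibilities
(`exists_code`). A few times and pieces recover the itinerary; for a fixed itinerary the grid name
is a sign pattern of polynomially many affine functions on the plane, and Sauer–Shelah bounds these.
Hence digits carry all entropy, metric (`metricEntropy_le`) and topological
(`topologicalEntropy_coneMap_le`).

Lower bounds: a slight bias towards digit `1` makes the walk positive recurrent with a geometric
stationary law, giving invariant measures with entropy close to `log 2`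
(`exists_log_two_sub_le_metricEntropy`). Independently of any variational principle, words made of
blocks with at least half ones keep the height bounded below and give enough separated orbits
(`le_topologicalEntropy_coneMap`).

No maximum: entropy `log 2` would make all digit words of each length equally likely. The spread of
the binomial distribution then puts mass at least `1/2` on height `0`; but such points have digits
`00` after one step, an event of mass `1/4` (`not_log_two_le_metricEntropy`). -/

/-- The first coordinate of the map. -/
def mapFst (x y : ℝ) : ℝ := max 0 (min (5 / 2 * x) (min (10 * (y - x)) 1))

/-- The second coordinate of the map. -/
def mapSnd (x y : ℝ) : ℝ := min (max (y / 2) (5 / 2 * x)) (min (2 * y) 1)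

/-- A piecewise affine map of the square. Near the origin it is homogeneous: it acts on the rays
`x = θ y` by a folding map with two full branches, and halves, respectively doubles, the height `y`
on the two branches. The height is truncated at `1`. -/
def coneMap (p : unitSquare) : unitSquare :=
  ⟨(mapFst p.1.1 p.1.2, mapSnd p.1.1 p.1.2), by
    obtain ⟨⟨x, y⟩, ⟨hx, hx'⟩, ⟨hy, hy'⟩⟩ := p
    simp only at hx hx' hy hy'
    refine ⟨⟨le_max_left _ _, ?_⟩, ⟨?_, ?_⟩⟩
    · exact max_le zero_le_one ((min_le_right _ _).trans (min_le_right _ _))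
    · exact le_min (le_max_of_le_left (by positivity)) (le_min (by simp; linarith) zero_le_one)
    · exact (min_le_right _ _).trans (min_le_right _ _)⟩

theorem continuous_coneMap : Continuous coneMap := by
  unfold coneMap mapFst mapSnd
  fun_prop

/-- The pieces of the square on which `coneMap` is affine. -/
inductive Piece
  | low | outLow | outHigh | gap | high | capped | corner
  deriving DecidableEq

instance : Fintype Piece :=
  ⟨{.low, .outLow, .outHigh, .gap, .high, .capped, .corner}, fun l => by cases l <;> decide⟩

instance : MeasurableSpace Piece := ⊤

instance : DiscreteMeasurableSpace Piece := ⟨fun _ => trivial⟩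

open Classical in
/-- The piece containing the point `(x, y)`. -/
def pieceAt (x y : ℝ) : Piece :=
  if 5 * x ≤ y then .low
  else if y ≤ x then (if y ≤ 1 / 2 then .outLow else .outHigh)
  else if x ≤ 2 / 5 ∧ 5 * x ≤ 4 * y then .gap
  else if y ≤ 1 / 2 then .high
  else if 10 * (y - x) ≤ 1 then .capped
  else .corner

/-- The piece containing a point of the square. -/
def piece (p : unitSquare) : Piece := pieceAt p.1.1 p.1.2

/-- The affine map of the plane with given coefficients. -/
def affineOfCoeffs (a b c a' b' c' : ℝ) : (ℝ × ℝ) →ᵃ[ℝ] (ℝ × ℝ) :=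
  ((((a • LinearMap.fst ℝ ℝ ℝ + b • LinearMap.snd ℝ ℝ ℝ).prod
    (a' • LinearMap.fst ℝ ℝ ℝ + b' • LinearMap.snd ℝ ℝ ℝ)).toAffineMap) +
    AffineMap.const ℝ (ℝ × ℝ) (c, c'))

@[simp]
theorem affineOfCoeffs_apply (a b c a' b' c' : ℝ) (p : ℝ × ℝ) :
    affineOfCoeffs a b c a' b' c' p = (a * p.1 + b * p.2 + c, a' * p.1 + b' * p.2 + c') := by
  simp [affineOfCoeffs]

/-- The affine map with which `coneMap` coincides on a piece. -/
def branch : Piece → (ℝ × ℝ) →ᵃ[ℝ] (ℝ × ℝ)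
  | .low => affineOfCoeffs (5 / 2) 0 0 0 (1 / 2) 0
  | .outLow => affineOfCoeffs 0 0 0 0 2 0
  | .outHigh => affineOfCoeffs 0 0 0 0 0 1
  | .gap => affineOfCoeffs (5 / 2) 0 0 (5 / 2) 0 0
  | .high => affineOfCoeffs (-10) 10 0 0 2 0
  | .capped => affineOfCoeffs (-10) 10 0 0 0 1
  | .corner => affineOfCoeffs 0 0 1 0 0 1

theorem coneMap_eq_branch (p : unitSquare) : (coneMap p : ℝ × ℝ) = branch (piece p) p := by
  obtain ⟨⟨x, y⟩, ⟨hx, hx'⟩, ⟨hy, hy'⟩⟩ := p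
  simp only at hx hx' hy hy'
  simp only [coneMap, piece, pieceAt, mapFst, mapSnd]
  split_ifs with h1 h2 h3 h4 h5 h6 <;> simp only [branch, affineOfCoeffs_apply, Prod.mk.injEq]
  all_goals try rw [not_and_or] at h4
  · rw [min_eq_left, max_eq_right, max_eq_left, min_eq_left]
    · constructor <;> ring
    · exact le_min (by linarith) (by linarith)
    · linarith
    · linarith
    · exact le_min (by linarith) (by linarith)
  · rw [max_eq_left, min_eq_right, min_eq_left]
    · constructor <;> ring
    · linarith
    · exact le_max_of_le_right ((min_le_left _ _).trans (by linarith))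
    · exact (min_le_right _ _).trans ((min_le_left _ _).trans (by linarith))
  · push Not at h3
    rw [max_eq_left, min_eq_right, min_eq_right]
    · constructor <;> ring
    · linarith
    · exact le_max_of_le_right ((min_le_right _ _).trans (by linarith))
    · exact (min_le_right _ _).trans ((min_le_left _ _).trans (by linarith))
  · push Not at h1 h2
    obtain ⟨h4, h5⟩ := h4
    rw [min_eq_left, max_eq_right, max_eq_right, min_eq_left]
    · constructor <;> ring
    · exact le_min (by linarith) (by linarith)
    · linarith
    · linarith
    · exact le_min (by linarith) (by linarith)
  · push Not at h1 h2 h4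
    -- If the gap condition fails through `x > 2/5`, then `5x > 2 ≥ 4y`, so both alternatives give
    -- the same inequality.
    have h6 : 4 * y < 5 * x := by rcases h4 with h | h <;> linarith
    rw [min_eq_right, max_eq_right, min_eq_left, max_eq_right (a := y / 2), min_eq_right,
      min_eq_left]
    · constructor <;> ring
    · linarith
    · exact (min_le_left _ _).trans (by linarith)
    · linarith
    · linarith
    · exact le_min (by linarith) (by linarith)
    · exact (min_le_left _ _).trans (by linarith)
  · push Not at h1 h2 h4 h5
    rw [min_eq_right, max_eq_right, min_eq_left, max_eq_right (a := y / 2), min_eq_right,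
      min_eq_right]
    · constructor <;> ring
    · linarith
    · exact (min_le_right _ _).trans (by linarith)
    · linarith
    · linarith
    · exact le_min (by linarith) (by linarith)
    · exact (min_le_left _ _).trans (by linarith)
  · push Not at h1 h2 h4 h5 h6
    have h7 : 2 / 5 < x := by rcases h4 with h | h <;> linarith
    rw [min_eq_right, max_eq_right, min_eq_right, max_eq_right (a := y / 2), min_eq_right,
      min_eq_right]
    · constructor <;> ring
    · linarith
    · exact (min_le_right _ _).trans (by linarith)
    · linarith
    · linarith
    · exact le_min (by linarith) (by linarith)
    · exact (min_le_right _ _).trans (by linarith)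

theorem convex_halfPlane_le (a b c : ℝ) : Convex ℝ {p : ℝ × ℝ | a * p.1 + b * p.2 ≤ c} :=
  convex_halfSpace_le (f := fun p : ℝ × ℝ => a * p.1 + b * p.2)
    ⟨fun p q => by simp only [Prod.fst_add, Prod.snd_add]; ring,
      fun r p => by simp only [Prod.smul_fst, Prod.smul_snd, smul_eq_mul]; ring⟩ c

theorem convex_halfPlane_lt (a b c : ℝ) : Convex ℝ {p : ℝ × ℝ | a * p.1 + b * p.2 < c} :=
  convex_halfSpace_lt (f := fun p : ℝ × ℝ => a * p.1 + b * p.2)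
    ⟨fun p q => by simp only [Prod.fst_add, Prod.snd_add]; ring,
      fun r p => by simp only [Prod.smul_fst, Prod.smul_snd, smul_eq_mul]; ring⟩ c

theorem convex_setOf_pieceAt (l : Piece) :
    Convex ℝ {p : ℝ × ℝ | p ∈ unitSquare ∧ pieceAt p.1 p.2 = l} := by
  have hsq : Convex ℝ unitSquare := (convex_Icc 0 1).prod (convex_Icc 0 1)
  have key : ∀ C : Set (ℝ × ℝ), Convex ℝ C →
      (∀ p ∈ unitSquare, pieceAt p.1 p.2 = l ↔ p ∈ C) →
      Convex ℝ {p : ℝ × ℝ | p ∈ unitSquare ∧ pieceAt p.1 p.2 = l} := by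
    intro C hC h
    convert hsq.inter hC using 1
    ext p
    exact and_congr_right (h p)
  -- The negated gap condition is a disjunction, hence not visibly convex. On either side of `y =
  -- 1/2` it reduces to a single half-plane.
  have split : ∀ x y : ℝ, (¬ (x ≤ 2 / 5 ∧ 5 * x ≤ 4 * y)) → y ≤ 1 / 2 → 4 * y < 5 * x := by
    intro x y h h'
    rcases not_and_or.1 h with h | h <;> linarith
  have split' : ∀ x y : ℝ, (¬ (x ≤ 2 / 5 ∧ 5 * x ≤ 4 * y)) → 1 / 2 < y → 2 / 5 < x := by
    intro x y h h'
    rcases not_and_or.1 h with h | h <;> linarith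
  cases l
  · refine key _ (convex_halfPlane_le 5 (-1) 0) fun p _ => ?_
    simp only [pieceAt, Set.mem_ofPred_eq]
    split_ifs <;> simp <;> linarith
  · refine key _ (((convex_halfPlane_lt (-5) 1 0).inter (convex_halfPlane_le (-1) 1 0)).inter
      (convex_halfPlane_le 0 1 (1 / 2))) fun p _ => ?_
    simp only [pieceAt, Set.mem_ofPred_eq, Set.mem_inter_iff]
    split_ifs <;> grind
  · refine key _ (((convex_halfPlane_lt (-5) 1 0).inter (convex_halfPlane_le (-1) 1 0)).inter
      (convex_halfPlane_lt 0 (-1) (-1 / 2))) fun p _ => ?_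
    simp only [pieceAt, Set.mem_ofPred_eq, Set.mem_inter_iff]
    split_ifs <;> grind
  · refine key _ ((((convex_halfPlane_lt (-5) 1 0).inter (convex_halfPlane_lt 1 (-1) 0)).inter
      (convex_halfPlane_le 1 0 (2 / 5))).inter (convex_halfPlane_le 5 (-4) 0)) fun p _ => ?_
    simp only [pieceAt, Set.mem_ofPred_eq, Set.mem_inter_iff]
    split_ifs <;> grind
  · refine key _ ((((convex_halfPlane_lt (-5) 1 0).inter (convex_halfPlane_lt 1 (-1) 0)).inter
      (convex_halfPlane_le 0 1 (1 / 2))).inter (convex_halfPlane_lt (-5) 4 0)) fun p _ => ?_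
    simp only [pieceAt, Set.mem_ofPred_eq, Set.mem_inter_iff]
    split_ifs <;> grind
  · refine key _ ((((convex_halfPlane_lt (-5) 1 0).inter (convex_halfPlane_lt 1 (-1) 0)).inter
      (convex_halfPlane_lt 0 (-1) (-1 / 2))).inter (convex_halfPlane_le (-10) 10 1)) fun p _ => ?_
    simp only [pieceAt, Set.mem_ofPred_eq, Set.mem_inter_iff]
    split_ifs <;> grind
  · refine key _ (((((convex_halfPlane_lt (-5) 1 0).inter (convex_halfPlane_lt 1 (-1) 0)).inter
      (convex_halfPlane_lt 0 (-1) (-1 / 2))).inter (convex_halfPlane_lt 10 (-10) (-1))).inter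
      (convex_halfPlane_lt (-1) 0 (-2 / 5))) fun p _ => ?_
    simp only [pieceAt, Set.mem_ofPred_eq, Set.mem_inter_iff]
    split_ifs <;> grind

theorem isPiecewiseAffine_coneMap : IsPiecewiseAffine coneMap := by
  refine ⟨Set.range fun l : Piece => {p : ℝ × ℝ | p ∈ unitSquare ∧ pieceAt p.1 p.2 = l},
    Set.finite_range _, ?_, ?_, ?_⟩
  · rintro _ ⟨l, rfl⟩ _ ⟨l', rfl⟩ hne
    refine Set.disjoint_left.2 fun p hp hp' => hne ?_
    have : l = l' := hp.2.symm.trans hp'.2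
    rw [this]
  · ext p
    simp only [Set.sUnion_range, Set.mem_iUnion, Set.mem_ofPred_eq]
    exact ⟨fun ⟨_, h, _⟩ => h, fun h => ⟨_, h, rfl⟩⟩
  · rintro _ ⟨l, rfl⟩
    refine ⟨convex_setOf_pieceAt l, branch l, fun x hx => ?_⟩
    rw [coneMap_eq_branch, piece, hx.2]

/-! ### Sign patterns of affine functions on the plane -/

/-- Affine functions on the plane form a space of dimension `3`, so four of them are dependent;
changing the sign of the relation makes some coefficient negative. -/
theorem exists_affine_relation {α : Type*} (s : Finset α) (f : α → (ℝ × ℝ) →ᵃ[ℝ] ℝ)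
    (hs : 3 < s.card) :
    ∃ c : s → ℝ, (∀ p, ∑ i, c i * f i p = 0) ∧ ∃ i, c i < 0 := by
  classical
  let v : s → ℝ × ℝ × ℝ := fun i => ((f i).linear (1, 0), (f i).linear (0, 1), f i 0)
  have hv : ¬ LinearIndependent ℝ v := by
    intro h
    have := h.fintype_card_le_finrank
    simp [Module.finrank_prod] at this
    omega
  obtain ⟨c, hc, i, hi⟩ := Fintype.not_linearIndependent_iff.1 hv
  have hf : ∀ (i : s) (p : ℝ × ℝ), f i p = p.1 * (v i).1 + p.2 * (v i).2.1 + (v i).2.2 := by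
    intro i p
    have h1 : f i p = (f i).linear p + f i 0 := by
      have := (f i).map_vadd 0 p
      simpa using this
    have h2 : p = p.1 • ((1 : ℝ), (0 : ℝ)) + p.2 • ((0 : ℝ), (1 : ℝ)) := by ext <;> simp
    rw [h1]
    conv_lhs => rw [h2]
    rw [map_add, map_smul, map_smul]
    rfl
  have hrel : ∀ p : ℝ × ℝ, ∑ i, c i * f i p = 0 := by
    intro p
    have h1 := congrArg Prod.fst hc
    have h2 := congrArg (fun q => q.2.1) hc
    have h3 := congrArg (fun q => q.2.2) hc
    simp only [Prod.fst_sum, Prod.snd_sum, Prod.smul_fst, Prod.smul_snd, smul_eq_mul, Prod.fst_zero,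
      Prod.snd_zero] at h1 h2 h3
    calc ∑ i, c i * f i p
        = p.1 * ∑ i, c i * (v i).1 + p.2 * ∑ i, c i * (v i).2.1 + ∑ i, c i * (v i).2.2 := by
          rw [Finset.mul_sum, Finset.mul_sum, ← Finset.sum_add_distrib, ← Finset.sum_add_distrib]
          refine Finset.sum_congr rfl fun i _ => ?_
          rw [hf]; ring
      _ = 0 := by rw [h1, h2, h3]; ring
  rcases lt_or_gt_of_ne hi with h | h
  · exact ⟨c, hrel, i, h⟩
  · exact ⟨fun i => -c i, fun p => by simpa using hrel p, i, by simpa using h⟩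

open Classical in
/-- The sets of indices at which a family of affine functions on the plane can be simultaneously
nonnegative, and negative elsewhere. -/
def signPatterns {α : Type*} [Fintype α] (f : α → (ℝ × ℝ) →ᵃ[ℝ] ℝ) : Finset (Finset α) :=
  Finset.univ.filter fun s => ∃ p, ∀ i, i ∈ s ↔ 0 ≤ f i p

/-- The patterns have VC dimension at most `3`, so Sauer–Shelah applies. If four functions were
shattered, some point would give each function the sign of its coefficient in an affine relation.
All terms of the relation would be nonnegative there and one positive, yet their sum is zero. -/
theorem card_signPatterns_le {α : Type*} [Fintype α] (f : α → (ℝ × ℝ) →ᵃ[ℝ] ℝ) :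
    (signPatterns f).card ≤ (Fintype.card α + 1) ^ 3 := by
  classical
  have hdim : (signPatterns f).vcDim ≤ 3 := by
    refine Finset.sup_le fun s hs => ?_
    rw [Finset.mem_shatterer] at hs
    by_contra hcard
    obtain ⟨c, hc, i, hi⟩ := exists_affine_relation s f (not_le.1 hcard)
    obtain ⟨u, hu, hsu⟩ := hs (t := s.filter fun j => ∃ h : j ∈ s, 0 ≤ c ⟨j, h⟩)
      (Finset.filter_subset _ _)
    obtain ⟨p, hp⟩ := (Finset.mem_filter.1 hu).2
    have hsign : ∀ j : s, 0 ≤ f j p ↔ 0 ≤ c j := by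
      intro j
      rw [← hp]
      have := Finset.ext_iff.1 hsu j
      simpa using this
    refine (Finset.sum_pos' (s := Finset.univ) (f := fun j : s => c j * f j p) ?_ ?_).ne' (hc p)
    · intro j _
      by_cases h : 0 ≤ c j
      · exact mul_nonneg h ((hsign j).2 h)
      · exact mul_nonneg_of_nonpos_of_nonpos (not_le.1 h).le
          (not_le.1 fun h' => h ((hsign j).1 h')).le
    · exact ⟨i, Finset.mem_univ _, mul_pos_of_neg_of_neg hi
        (not_le.1 fun h' => not_le.2 hi ((hsign i).1 h'))⟩
  set N := Fintype.card α
  calc (signPatterns f).card ≤ (signPatterns f).shatterer.card := Finset.card_le_card_shatterer _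
    _ ≤ ∑ k ∈ Finset.Iic (signPatterns f).vcDim, N.choose k :=
        Finset.card_shatterer_le_sum_vcDim
    _ ≤ ∑ k ∈ Finset.Iic 3, N.choose k :=
        Finset.sum_le_sum_of_subset (Finset.Iic_subset_Iic.2 hdim)
    _ ≤ ∑ k ∈ Finset.Iic 3, N ^ k := Finset.sum_le_sum fun k _ => Nat.choose_le_pow _ _
    _ = N ^ 0 + N ^ 1 + N ^ 2 + N ^ 3 := by
        rw [show Finset.Iic 3 = Finset.range 4 from rfl]
        simp [Finset.sum_range_succ]
    _ ≤ (N + 1) ^ 3 := by nlinarith [Nat.zero_le N]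

theorem exists_injOn_fin {β : Type*} (A : Finset β) {Q : ℕ} (hQ : 0 < Q) (hA : A.card ≤ Q) :
    ∃ enc : β → Fin Q, Set.InjOn enc A := by
  classical
  refine ⟨fun b => if h : b ∈ A then Fin.castLE hA (A.equivFin ⟨b, h⟩) else ⟨0, hQ⟩, ?_⟩
  intro a ha b hb hab
  rw [Finset.mem_coe] at ha hb
  simpa [ha, hb] using hab

/-- A map out of a discrete space is measurable however it is chosen; this covers the codes below,
whose encodings come from choice. -/
theorem measurable_of_factorsThrough {X A B : Type*} [MeasurableSpace X] [MeasurableSpace A]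
    [DiscreteMeasurableSpace A] [MeasurableSpace B] {W : X → A} (hW : Measurable W) {e : X → B}
    (h : ∀ x y, W x = W y → e x = e y) : Measurable e := by
  rcases isEmpty_or_nonempty X with hX | hX
  · exact measurable_of_empty e
  obtain ⟨x₀⟩ := hX
  have : e = Function.extend W e (fun _ => e x₀) ∘ W := by
    funext x
    exact (Function.FactorsThrough.extend_apply (fun x y hxy => h x y hxy) _ x).symm
  rw [this]
  exact (Measurable.of_discrete).comp hW

/-! ### Itineraries -/

theorem measurable_piece : Measurable piece := by
  have hx : Measurable fun p : unitSquare => p.1.1 := by fun_prop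
  have hy : Measurable fun p : unitSquare => p.1.2 := by fun_prop
  unfold piece pieceAt
  refine Measurable.ite (measurableSet_le (by fun_prop) (by fun_prop)) measurable_const ?_
  refine Measurable.ite (measurableSet_le (by fun_prop) (by fun_prop)) ?_ ?_
  · exact Measurable.ite (measurableSet_le (by fun_prop) (by fun_prop)) measurable_const
      measurable_const
  refine Measurable.ite (MeasurableSet.inter (s₁ := {p : unitSquare | p.1.1 ≤ 2 / 5})
    (s₂ := {p : unitSquare | 5 * p.1.1 ≤ 4 * p.1.2}) (measurableSet_le (by fun_prop) (by fun_prop))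
    (measurableSet_le (by fun_prop) (by fun_prop))) measurable_const ?_
  refine Measurable.ite (measurableSet_le (by fun_prop) (by fun_prop)) measurable_const ?_
  exact Measurable.ite (measurableSet_le (by fun_prop) (by fun_prop)) measurable_const
    measurable_const

theorem measurable_coneMap_iterate (n : ℕ) : Measurable coneMap^[n] :=
  (continuous_coneMap.iterate n).measurable

/-- The symbol of a point: `0` on the branch which halves the height, `1` elsewhere. -/
def digit (p : unitSquare) : Fin 2 := if piece p = .low then 0 else 1

theorem measurable_digit : Measurable digit :=
  measurable_of_factorsThrough measurable_piece fun x y h => by simp only [digit, h]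

/-- The pieces in which recurrent points can lie. -/
def Piece.IsLive (l : Piece) : Prop := l = .low ∨ l = .high ∨ l = .capped

theorem piece_eq_low_iff {p : unitSquare} : piece p = .low ↔ 5 * p.1.1 ≤ p.1.2 := by
  unfold piece pieceAt
  split_ifs <;> simp_all

theorem digit_eq_zero_iff {p : unitSquare} : digit p = 0 ↔ piece p = .low := by
  unfold digit
  split_ifs <;> simp_all

/-- As long as the orbit stays live, the digit and the height alone fix the piece. -/
theorem piece_of_isLive {p : unitSquare} (h : (piece p).IsLive) :
    piece p = if digit p = 0 then .low else if p.1.2 ≤ 1 / 2 then .high else .capped := by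
  revert h
  unfold digit piece pieceAt Piece.IsLive
  split_ifs <;> simp_all

theorem coneMap_snd_of_isLive {p : unitSquare} (h : (piece p).IsLive) :
    (coneMap p).1.2 = if piece p = .low then p.1.2 / 2 else if piece p = .high then 2 * p.1.2
      else 1 := by
  rw [coneMap_eq_branch]
  rcases h with h | h | h <;> simp [h, branch]
  ring

/-- The two outer pieces collapse onto `x = 0`; the gap and the corner are sent to the diagonal away
from the origin, which lies in the outer pieces. So two steps after leaving the live pieces the
orbit is on the axis. -/
theorem piece_coneMap_of_not_isLive {p : unitSquare} (h : ¬ (piece p).IsLive) :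
    (coneMap p).1.1 = 0 ∨
      (piece (coneMap p) = .outLow ∨ piece (coneMap p) = .outHigh) := by
  have hout : ∀ q : unitSquare, 0 < q.1.2 → q.1.1 = q.1.2 →
      piece q = .outLow ∨ piece q = .outHigh := by
    intro q h0 h1
    unfold piece pieceAt
    rw [if_neg (by linarith), if_pos h1.ge]
    split_ifs <;> simp
  cases hp : piece p
  · exact absurd (Or.inl hp) h
  · left; rw [coneMap_eq_branch, hp]; simp [branch]
  · left; rw [coneMap_eq_branch, hp]; simp [branch]
  · right
    have : 0 < p.1.1 := by
      have h1 : ¬ piece p = .low := by simp [hp]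
      rw [piece_eq_low_iff] at h1
      have := p.2.2.1
      linarith
    apply hout <;> rw [coneMap_eq_branch, hp] <;> simp [branch, this]
  · exact absurd (Or.inr (Or.inl hp)) h
  · exact absurd (Or.inr (Or.inr hp)) h
  · right
    apply hout <;> rw [coneMap_eq_branch, hp] <;> simp [branch]

theorem coneMap_fst_of_out {p : unitSquare} (h : piece p = .outLow ∨ piece p = .outHigh) :
    (coneMap p).1.1 = 0 := by
  rw [coneMap_eq_branch]
  rcases h with h | h <;> simp [h, branch]

theorem piece_of_fst_eq_zero {p : unitSquare} (h : p.1.1 = 0) : piece p = .low := by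
  rw [piece_eq_low_iff, h]
  simpa using p.2.2.1

theorem coneMap_fst_of_fst_eq_zero {p : unitSquare} (h : p.1.1 = 0) : (coneMap p).1.1 = 0 := by
  rw [coneMap_eq_branch, piece_of_fst_eq_zero h]
  simp [branch, h]

theorem iterate_fst_eq_zero_of_le {p : unitSquare} {i j : ℕ} (hij : i ≤ j)
    (h : (coneMap^[i] p).1.1 = 0) : (coneMap^[j] p).1.1 = 0 := by
  induction j, hij using Nat.le_induction with
  | base => exact h
  | succ j _ ih => rw [Function.iterate_succ_apply']; exact coneMap_fst_of_fst_eq_zero ih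

/-- The itinerary of a point through the pieces. -/
def itinerary (p : unitSquare) (i : ℕ) : Piece := piece (coneMap^[i] p)

theorem itinerary_eq_low_of_not_isLive {p : unitSquare} {t : ℕ} (h : ¬ (itinerary p t).IsLive)
    {i : ℕ} (hi : t + 2 ≤ i) : itinerary p i = .low := by
  refine piece_of_fst_eq_zero (iterate_fst_eq_zero_of_le hi ?_)
  rw [Function.iterate_succ_apply', Function.iterate_succ_apply']
  rcases piece_coneMap_of_not_isLive h with h | h
  · exact coneMap_fst_of_fst_eq_zero h
  · exact coneMap_fst_of_out h

/-- The first time at which `P` holds, truncated at `n`. -/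
def firstTime (n : ℕ) (P : ℕ → Prop) : ℕ := sInf {i | P i ∨ i = n}

theorem firstTime_le (n : ℕ) (P : ℕ → Prop) : firstTime n P ≤ n := Nat.sInf_le (Or.inr rfl)

theorem not_of_lt_firstTime {n i : ℕ} {P : ℕ → Prop} (h : i < firstTime n P) : ¬ P i :=
  fun h' => Nat.notMem_of_lt_sInf h (Or.inl h')

theorem firstTime_spec {n : ℕ} {P : ℕ → Prop} (h : firstTime n P < n) : P (firstTime n P) := by
  have : firstTime n P ∈ {i | P i ∨ i = n} := Nat.sInf_mem ⟨n, Or.inr rfl⟩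
  exact this.resolve_right h.ne

theorem firstTime_congr {n : ℕ} {P Q : ℕ → Prop} (h : ∀ i < n, P i ↔ Q i) :
    firstTime n P = firstTime n Q := by
  have key : ∀ {P Q : ℕ → Prop}, (∀ i < n, P i ↔ Q i) → firstTime n P ≤ firstTime n Q := by
    intro P Q h
    rcases (firstTime_le n Q).lt_or_eq with hlt | heq
    · exact Nat.sInf_le (Or.inl ((h _ hlt).2 (firstTime_spec hlt)))
    · rw [heq]; exact firstTime_le _ _
  exact le_antisymm (key h) (key fun i hi => (h i hi).symm)

/-- The first time at which the orbit leaves the live pieces. -/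
def deathTime (n : ℕ) (p : unitSquare) : ℕ := firstTime n fun i => ¬ (itinerary p i).IsLive

/-- The first time at which the height is truncated. -/
def capTime (n : ℕ) (p : unitSquare) : ℕ := firstTime n fun i => itinerary p i = .capped

/-- Before the first truncation, digit `1` on a live orbit means `high`. At truncation the height
becomes exactly `1`, and from then on digits determine heights and hence pieces. After death two
pieces remain unknown, and then everything is `low`. -/
theorem itinerary_congr {n : ℕ} {p q : unitSquare}
    (hw : ∀ i < n, digit (coneMap^[i] p) = digit (coneMap^[i] q))
    (hd : deathTime n p = deathTime n q) (hc : capTime n p = capTime n q)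
    (h0 : itinerary p (deathTime n p) = itinerary q (deathTime n p))
    (h1 : itinerary p (deathTime n p + 1) = itinerary q (deathTime n p + 1)) :
    ∀ i < n, itinerary p i = itinerary q i := by
  set t := deathTime n p with ht
  have htn : t ≤ n := firstTime_le _ _
  have hlp : ∀ i < t, (itinerary p i).IsLive := fun i hi =>
    not_not.1 (not_of_lt_firstTime hi)
  have hlq : ∀ i < t, (itinerary q i).IsLive := fun i hi =>
    not_not.1 (not_of_lt_firstTime (show i < deathTime n q from hd ▸ hi))
  have same : ∀ i < t, (capTime n p < i → (coneMap^[i] p).1.2 = (coneMap^[i] q).1.2) →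
      itinerary p i = itinerary q i := by
    intro i hi hy
    have hin := hi.trans_le htn
    rcases lt_trichotomy i (capTime n p) with hlt | heq | hgt
    · have hp := piece_of_isLive (hlp i hi)
      have hq := piece_of_isLive (hlq i hi)
      have hp' : ¬ itinerary p i = .capped := not_of_lt_firstTime hlt
      have hq' : ¬ itinerary q i = .capped := not_of_lt_firstTime (show i < capTime n q from hc ▸ hlt)
      simp only [itinerary] at hp' hq' ⊢
      rw [hw i hin] at hp
      grind
    · have hp : itinerary p (capTime n p) = .capped := firstTime_spec (heq ▸ hin)
      have hq : itinerary q (capTime n q) = .capped := firstTime_spec (hc ▸ heq ▸ hin)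
      rw [heq, hp, hc, hq]
    · have hp := piece_of_isLive (hlp i hi)
      have hq := piece_of_isLive (hlq i hi)
      simp only [itinerary]
      rw [hp, hq, hw i hin, hy hgt]
  have height : ∀ i, capTime n p < i → i ≤ t →
      (coneMap^[i] p).1.2 = (coneMap^[i] q).1.2 := by
    intro i
    induction i with
    | zero => intro h; omega
    | succ i ih =>
      intro h hit
      have hpq : piece (coneMap^[i] p) = piece (coneMap^[i] q) :=
        same i hit fun h' => ih h' (by omega)
      rw [Function.iterate_succ_apply', Function.iterate_succ_apply',
        coneMap_snd_of_isLive (hlp i hit), coneMap_snd_of_isLive (hlq i hit), ← hpq]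
      rcases (Nat.lt_succ_iff.1 h).eq_or_lt with heq | hlt
      · have hp : piece (coneMap^[i] p) = .capped := by
          have hlt : capTime n p < n := by omega
          rw [← heq]; exact firstTime_spec hlt
        simp [hp]
      · rw [ih hlt (by omega)]
  intro i hi
  rcases lt_or_ge i t with hit | hit
  · exact same i hit fun h => height i h hit.le
  rcases hit.eq_or_lt with rfl | hit
  · exact h0
  rcases (Nat.succ_le_of_lt hit).eq_or_lt with rfl | hit
  · exact h1
  have htn' : t < n := by omega
  rw [itinerary_eq_low_of_not_isLive (t := t) (firstTime_spec htn') hit,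
    itinerary_eq_low_of_not_isLive (t := t) (by rw [hd]; exact firstTime_spec (hd ▸ htn')) hit]

/-- The composition of the branches along a sequence of pieces. -/
def branchIter (a : ℕ → Piece) : ℕ → (ℝ × ℝ) →ᵃ[ℝ] (ℝ × ℝ)
  | 0 => AffineMap.id ℝ _
  | i + 1 => (branch (a i)).comp (branchIter a i)

theorem branchIter_congr {a b : ℕ → Piece} {i : ℕ} (h : ∀ j < i, a j = b j) :
    branchIter a i = branchIter b i := by
  induction i with
  | zero => rfl
  | succ i ih =>
    rw [branchIter, branchIter, ih fun j hj => h j (hj.trans i.lt_succ_self), h i i.lt_succ_self]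

theorem iterate_eq_branchIter (p : unitSquare) (i : ℕ) :
    (coneMap^[i] p : ℝ × ℝ) = branchIter (itinerary p) i p := by
  induction i with
  | zero => rfl
  | succ i ih =>
    rw [Function.iterate_succ_apply', coneMap_eq_branch, ih]
    rfl

/-! ### Grid partitions -/

/-- The cell of a point in the grid of mesh `1 / m`. -/
def gridCell (m : ℕ) (p : unitSquare) : Fin (m + 1) × Fin (m + 1) :=
  (⟨⌊(m : ℝ) * p.1.1⌋₊, Nat.lt_succ_of_le (Nat.floor_le_of_le
    (mul_le_of_le_one_right m.cast_nonneg p.2.1.2))⟩,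
   ⟨⌊(m : ℝ) * p.1.2⌋₊, Nat.lt_succ_of_le (Nat.floor_le_of_le
    (mul_le_of_le_one_right m.cast_nonneg p.2.2.2))⟩)

theorem measurable_gridCell (m : ℕ) : Measurable (gridCell m) := by
  refine Measurable.prodMk ?_ ?_
  · refine measurable_of_factorsThrough (W := fun p : unitSquare => ⌊(m : ℝ) * p.1.1⌋₊)
      (Nat.measurable_floor.comp (by fun_prop)) fun x y h => Fin.ext h
  · refine measurable_of_factorsThrough (W := fun p : unitSquare => ⌊(m : ℝ) * p.1.2⌋₊)
      (Nat.measurable_floor.comp (by fun_prop)) fun x y h => Fin.ext h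

theorem dist_lt_of_gridCell_eq {m : ℕ} (hm : 0 < m) {p q : unitSquare}
    (h : gridCell m p = gridCell m q) : dist p q < 1 / m := by
  have hm' : (0 : ℝ) < m := Nat.cast_pos.2 hm
  have key : ∀ a b : ℝ, 0 ≤ a → 0 ≤ b → ⌊(m : ℝ) * a⌋₊ = ⌊(m : ℝ) * b⌋₊ → dist a b < 1 / m := by
    intro a b ha hb hab
    have h1 := Nat.floor_le (mul_nonneg hm'.le ha)
    have h2 := Nat.floor_le (mul_nonneg hm'.le hb)
    have h3 := Nat.lt_floor_add_one ((m : ℝ) * a)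
    have h4 := Nat.lt_floor_add_one ((m : ℝ) * b)
    rw [hab] at h1 h3
    rw [Real.dist_eq, lt_div_iff₀ hm', show |a - b| * (m : ℝ) = |(a - b) * m| by rw [abs_mul, Nat.abs_cast], abs_lt]
    constructor <;> linarith
  have h1 := congrArg (fun c => (c.1 : ℕ)) h
  have h2 := congrArg (fun c => (c.2 : ℕ)) h
  exact max_lt (key _ _ p.2.1.1 q.2.1.1 h1) (key _ _ p.2.2.1 q.2.2.1 h2)

/-- The functions whose signs along an orbit determine its grid name. -/
def gridFunction (m n : ℕ) (a : ℕ → Piece) (i : (Fin n × Fin (m + 1)) × Bool) :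
    (ℝ × ℝ) →ᵃ[ℝ] ℝ :=
  (m : ℝ) • (((bif i.2 then AffineMap.fst else AffineMap.snd : (ℝ × ℝ) →ᵃ[ℝ] ℝ)).comp
    (branchIter a i.1.1)) - AffineMap.const ℝ _ ((i.1.2 : ℕ) : ℝ)

/-- The set of grid functions which are nonnegative at a point, in terms of its grid name. -/
def gridPattern (m n : ℕ) (g : Fin n → Fin (m + 1) × Fin (m + 1)) :
    Finset ((Fin n × Fin (m + 1)) × Bool) :=
  Finset.univ.filter fun i => i.1.2 ≤ bif i.2 then (g i.1.1).1 else (g i.1.1).2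

/-- Each cell coordinate is the largest threshold in its part of the pattern. -/
theorem gridPattern_injective (m n : ℕ) : Function.Injective (gridPattern m n) := by
  intro g g' h
  have key : ∀ (i : Fin n) (c : Bool), (bif c then (g i).1 else (g i).2) =
      bif c then (g' i).1 else (g' i).2 := by
    intro i c
    refine le_antisymm ?_ ?_
    · have := Finset.ext_iff.1 h ((i, bif c then (g i).1 else (g i).2), c)
      simpa [gridPattern] using this
    · have := Finset.ext_iff.1 h ((i, bif c then (g' i).1 else (g' i).2), c)
      simpa [gridPattern] using this
  funext i
  exact Prod.ext (key i true) (key i false)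

theorem gridPattern_mem_signPatterns (m n : ℕ) (a : ℕ → Piece) (p : unitSquare)
    (ha : ∀ i < n, itinerary p i = a i) :
    gridPattern m n (joinedPartition coneMap (gridCell m) n p) ∈
      signPatterns (gridFunction m n a) := by
  simp only [signPatterns, Finset.mem_filter, Finset.mem_univ, true_and]
  refine ⟨p, ?_⟩
  rintro ⟨⟨i, j⟩, c⟩
  have h : branchIter a i (p : ℝ × ℝ) = (coneMap^[i] p : ℝ × ℝ) := by
    rw [iterate_eq_branchIter, branchIter_congr fun j hj => ha j (hj.trans i.2)]
  have h1 : (0 : ℝ) ≤ m * (coneMap^[i] p).1.1 := mul_nonneg m.cast_nonneg (coneMap^[i] p).2.1.1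
  have h2 : (0 : ℝ) ≤ m * (coneMap^[i] p).1.2 := mul_nonneg m.cast_nonneg (coneMap^[i] p).2.2.1
  simp only [gridPattern, Finset.mem_filter, Finset.mem_univ, true_and]
  cases c
  · rw [show gridFunction m n a ((i, j), false) p = m * (branchIter a i p).2 - (j : ℕ) from rfl,
      h, sub_nonneg, ← Nat.le_floor_iff h2]
    rfl
  · rw [show gridFunction m n a ((i, j), true) p = m * (branchIter a i p).1 - (j : ℕ) from rfl,
      h, sub_nonneg, ← Nat.le_floor_iff h1]
    rfl

/-- The type of codes for the grid names of length `n` with given digits. -/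
abbrev Code (m n : ℕ) : Type :=
  (Fin (n + 1) × Fin (n + 1) × Piece × Piece) × Fin ((n * (m + 1) * 2 + 1) ^ 3)

/-- Given the digits of a point, polynomially many codes suffice to determine its grid name. -/
theorem exists_code (m n : ℕ) : ∃ e : unitSquare → Code m n, Measurable e ∧
    ∀ p q, joinedPartition coneMap digit n p = joinedPartition coneMap digit n q → e p = e q →
      joinedPartition coneMap (gridCell m) n p = joinedPartition coneMap (gridCell m) n q := by
  have henc : ∀ a : ℕ → Piece, ∃ enc : Finset ((Fin n × Fin (m + 1)) × Bool) →
      Fin ((n * (m + 1) * 2 + 1) ^ 3), Set.InjOn enc (signPatterns (gridFunction m n a)) := by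
    intro a
    refine exists_injOn_fin _ (by positivity) ?_
    simpa using card_signPatterns_le (gridFunction m n a)
  choose enc henc using henc
  let ext : (Fin n → Piece) → ℕ → Piece := fun a i => if h : i < n then a ⟨i, h⟩ else .low
  have hext : ∀ p : unitSquare, ∀ i < n, itinerary p i = ext (fun i => itinerary p i) i := by
    intro p i hi
    simp [ext, hi]
  refine ⟨fun p => ((⟨deathTime n p, Nat.lt_succ_of_le (firstTime_le _ _)⟩,
    ⟨capTime n p, Nat.lt_succ_of_le (firstTime_le _ _)⟩,
    itinerary p (deathTime n p), itinerary p (deathTime n p + 1)),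
    enc (ext fun i => itinerary p i)
      (gridPattern m n (joinedPartition coneMap (gridCell m) n p))), ?_, ?_⟩
  -- The death time can equal `n` and the piece one step later is recorded, so the itinerary is
  -- needed up to index `n + 1`.
  · refine measurable_of_factorsThrough (W := fun p : unitSquare =>
      ((fun i : Fin (n + 2) => itinerary p i), joinedPartition coneMap (gridCell m) n p)) ?_ ?_
    · refine Measurable.prodMk (measurable_pi_lambda _ fun i => ?_)
        (measurable_pi_lambda _ fun i => ?_)
      · exact measurable_piece.comp (measurable_coneMap_iterate i)
      · exact (measurable_gridCell m).comp (measurable_coneMap_iterate i)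
    · intro p q h
      have h1 : ∀ i < n + 2, itinerary p i = itinerary q i := fun i hi =>
        congrFun (congrArg Prod.fst h) ⟨i, hi⟩
      have h2 : joinedPartition coneMap (gridCell m) n p =
        joinedPartition coneMap (gridCell m) n q := congrArg Prod.snd h
      have hd : deathTime n p = deathTime n q :=
        firstTime_congr fun i hi => by rw [h1 i (by omega)]
      have hc : capTime n p = capTime n q :=
        firstTime_congr fun i hi => by rw [h1 i (by omega)]
      have hdn : deathTime n q ≤ n := firstTime_le _ _
      have h3 : (fun i : Fin n => itinerary p i) = fun i : Fin n => itinerary q i :=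
        funext fun i => h1 i (by omega)
      simp only [hd, hc, h2, h3, h1 _ (show deathTime n q < n + 2 by omega),
        h1 _ (show deathTime n q + 1 < n + 2 by omega)]
  · intro p q hw he
    simp only [Prod.mk.injEq, Fin.mk.injEq] at he
    obtain ⟨⟨hd, hc, h0, h1⟩, hpat⟩ := he
    have hit := itinerary_congr (fun i hi => congrFun hw ⟨i, hi⟩) hd hc
      (by rw [h0, hd]) (by rw [h1, hd])
    have h3 : (fun i : Fin n => itinerary p i) = fun i : Fin n => itinerary q i :=
      funext fun i => hit i i.2
    rw [h3] at hpat
    refine gridPattern_injective m n (henc _ ?_ ?_ hpat)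
    · exact gridPattern_mem_signPatterns m n _ p fun i hi => by rw [hit i hi]; exact hext q i hi
    · exact gridPattern_mem_signPatterns m n _ q (hext q)

/-! ### Entropy of finite partitions -/

section Entropy

set_option linter.unusedSectionVars false

variable {X A B : Type*} [MeasurableSpace X] [Fintype A] [MeasurableSpace A]
  [DiscreteMeasurableSpace A] [Fintype B] [MeasurableSpace B] [DiscreteMeasurableSpace B]
  {μ : Measure X}

/-- Gibbs' inequality `-log z ≤ 1/z - 1` with `z = u / (s t)`, scaled by `u`. The last hypothesis
handles the convention `log 0 = 0`. -/
theorem negMulLog_mul_le {s t u : ℝ} (hs : 0 ≤ s) (ht : 0 ≤ t) (hu : 0 ≤ u) (h : s * t = 0 → u = 0) :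
    Real.negMulLog u ≤ -(u * Real.log s) - u * Real.log t + (s * t - u) := by
  rcases eq_or_lt_of_le (mul_nonneg hs ht) with h0 | hpos
  · rw [h h0.symm, ← h0]; simp
  have hs' : s ≠ 0 := left_ne_zero_of_mul hpos.ne'
  have ht' : t ≠ 0 := right_ne_zero_of_mul hpos.ne'
  have h1 : Real.negMulLog (u / (s * t)) ≤ 1 - u / (s * t) :=
    Real.negMulLog_le_one_sub_self (by positivity)
  have h2 : Real.negMulLog u = Real.negMulLog (s * t * (u / (s * t))) := by
    rw [mul_div_cancel₀ _ hpos.ne']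
  rw [h2, Real.negMulLog_mul, Real.negMulLog, Real.log_mul hs' ht']
  have h3 := mul_le_mul_of_nonneg_left h1 hpos.le
  have h4 : s * t * (1 - u / (s * t)) = s * t - u := by field_simp
  have h5 : u / (s * t) * (-(s * t) * (Real.log s + Real.log t)) =
      -(u * Real.log s) - u * Real.log t := by field_simp; ring
  rw [h5]
  linarith

theorem negMulLog_sum_le {ι : Type*} (s : Finset ι) (p : ι → ℝ) (hp : ∀ i ∈ s, 0 ≤ p i) :
    Real.negMulLog (∑ i ∈ s, p i) ≤ ∑ i ∈ s, Real.negMulLog (p i) := by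
  rw [Real.negMulLog, neg_mul, Finset.sum_mul, ← Finset.sum_neg_distrib]
  refine Finset.sum_le_sum fun i hi => ?_
  rw [Real.negMulLog, neg_mul, neg_le_neg_iff]
  rcases eq_or_lt_of_le (hp i hi) with h | h
  · simp [← h]
  · exact mul_le_mul_of_nonneg_left (Real.log_le_log h (Finset.single_le_sum hp hi)) h.le

theorem measureReal_preimage_eq_sum [IsFiniteMeasure μ] {g : X → B} (hg : Measurable g) (s : Set X)
    (t : Finset B) (φ : B → Set X) (hφ : ∀ b ∈ t, φ b = s ∩ g ⁻¹' {b}) (hs : ∀ x ∈ s, g x ∈ t) :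
    μ.real s = ∑ b ∈ t, μ.real (φ b) := by
  have h1 : ∀ b ∈ t, μ.real (φ b) = (μ.restrict s).real (g ⁻¹' {b}) := by
    intro b hb
    rw [hφ b hb, measureReal_restrict_apply (hg (MeasurableSet.of_discrete)), Set.inter_comm]
  rw [Finset.sum_congr rfl h1, sum_measureReal_preimage_singleton t
    (fun b _ => hg (MeasurableSet.of_discrete)),
    measureReal_restrict_apply (hg (MeasurableSet.of_discrete))]
  congr 1
  ext x
  simp only [Set.mem_inter_iff, Set.mem_preimage, SetLike.mem_coe]
  exact ⟨fun h => ⟨hs x h, h⟩, fun h => h.2⟩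

theorem sum_measureReal_fiber [IsProbabilityMeasure μ] {f : X → A} (hf : Measurable f) :
    ∑ a, μ.real (f ⁻¹' {a}) = 1 := by
  rw [sum_measureReal_preimage_singleton _ (fun b _ => hf (MeasurableSet.of_discrete))]
  simp

/-- Sum Gibbs' inequality comparing the joint law with the product of its marginals; the linear
corrections cancel because both laws have total mass `1`. -/
theorem partitionEntropy_prod_le [IsProbabilityMeasure μ] {f : X → A} {g : X → B}
    (hf : Measurable f) (hg : Measurable g) :
    partitionEntropy μ (fun x => (f x, g x)) ≤ partitionEntropy μ f + partitionEntropy μ g := by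
  set r : A → B → ℝ := fun a b => μ.real ((fun x => (f x, g x)) ⁻¹' {(a, b)}) with hr
  set p : A → ℝ := fun a => μ.real (f ⁻¹' {a})
  set q : B → ℝ := fun b => μ.real (g ⁻¹' {b})
  have hp : ∀ a, p a = ∑ b, r a b := fun a => by
    refine measureReal_preimage_eq_sum hg _ _ _ (fun b _ => ?_) (fun x _ => Finset.mem_univ _)
    ext x; simp
  have hq : ∀ b, q b = ∑ a, r a b := fun b => by
    refine measureReal_preimage_eq_sum hf _ _ _ (fun a _ => ?_) (fun x _ => Finset.mem_univ _)
    ext x; simp [and_comm]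
  have hp1 : ∑ a, p a = 1 := sum_measureReal_fiber hf
  have hq1 : ∑ b, q b = 1 := sum_measureReal_fiber hg
  have hrp : ∀ a b, r a b ≤ p a := fun a b => by
    rw [hp]
    exact Finset.single_le_sum (f := fun b => r a b) (fun _ _ => measureReal_nonneg)
      (Finset.mem_univ b)
  have hrq : ∀ a b, r a b ≤ q b := fun a b => by
    rw [hq]
    exact Finset.single_le_sum (f := fun a => r a b) (fun _ _ => measureReal_nonneg)
      (Finset.mem_univ a)
  have hr0 : ∀ a b, 0 ≤ r a b := fun a b => measureReal_nonneg
  have hr1 : ∑ a, ∑ b, r a b = 1 := by rw [← hp1]; exact Finset.sum_congr rfl fun a _ => (hp a).symm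
  have key : ∀ a b, Real.negMulLog (r a b) ≤
      -(r a b * Real.log (p a)) - r a b * Real.log (q b) + (p a * q b - r a b) := by
    intro a b
    refine negMulLog_mul_le measureReal_nonneg measureReal_nonneg (hr0 a b) fun h => ?_
    rcases mul_eq_zero.1 h with h | h
    · exact le_antisymm ((hrp a b).trans h.le) (hr0 a b)
    · exact le_antisymm ((hrq a b).trans h.le) (hr0 a b)
  calc partitionEntropy μ (fun x => (f x, g x)) = ∑ a, ∑ b, Real.negMulLog (r a b) := by
        rw [partitionEntropy, Fintype.sum_prod_type]
    _ ≤ ∑ a, ∑ b, (-(r a b * Real.log (p a)) - r a b * Real.log (q b) + (p a * q b - r a b)) :=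
        Finset.sum_le_sum fun a _ => Finset.sum_le_sum fun b _ => key a b
    _ = -(∑ a, ∑ b, r a b * Real.log (p a)) - ∑ a, ∑ b, r a b * Real.log (q b) +
          ((∑ a, p a) * (∑ b, q b) - ∑ a, ∑ b, r a b) := by
        rw [Finset.sum_mul_sum]
        simp only [Finset.sum_add_distrib, Finset.sum_sub_distrib, Finset.sum_neg_distrib]
    _ = -(∑ a, p a * Real.log (p a)) - ∑ b, q b * Real.log (q b) := by
        rw [hp1, hq1, hr1, Finset.sum_comm (f := fun a b => r a b * Real.log (q b))]
        simp only [← Finset.sum_mul, ← hp, ← hq]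
        ring
    _ = partitionEntropy μ f + partitionEntropy μ g := by
        simp only [partitionEntropy, Real.negMulLog, neg_mul, Finset.sum_neg_distrib]
        ring

theorem partitionEntropy_le_of_factorsThrough [IsFiniteMeasure μ] {f : X → A} {g : X → B}
    (hg : Measurable g) (h : ∀ x y, g x = g y → f x = f y) :
    partitionEntropy μ f ≤ partitionEntropy μ g := by
  classical
  rcases isEmpty_or_nonempty X with hX | hX
  · simp [partitionEntropy, Measure.eq_zero_of_isEmpty μ]
  obtain ⟨x₀⟩ := hX
  let φ : B → A := Function.extend g f fun _ => f x₀
  have hφ : ∀ x, φ (g x) = f x := fun x =>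
    Function.FactorsThrough.extend_apply (fun x y hxy => h x y hxy) _ x
  rw [partitionEntropy, partitionEntropy, ← Finset.sum_fiberwise Finset.univ φ]
  refine Finset.sum_le_sum fun a _ => ?_
  rw [measureReal_preimage_eq_sum hg (f ⁻¹' {a}) (Finset.univ.filter fun b => φ b = a)
    (fun b => g ⁻¹' {b})]
  · exact negMulLog_sum_le _ _ fun b _ => measureReal_nonneg
  · intro b hb
    rw [Finset.mem_filter] at hb
    ext x
    simp only [Set.mem_preimage, Set.mem_singleton_iff, Set.mem_inter_iff]
    refine ⟨fun hx => ⟨?_, hx⟩, fun hx => hx.2⟩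
    rw [← hφ, hx, hb.2]
  · intro x hx
    simp only [Finset.mem_filter, Finset.mem_univ, true_and, hφ]
    exact hx

/-- The tangent line of `negMulLog` at `1 / N`, with the equality case given by strict concavity.
Summed over `N` atoms it bounds the entropy and identifies the maximizer. -/
theorem negMulLog_le_mul_log_add {N p : ℝ} (hN : 0 < N) (hp : 0 ≤ p) :
    Real.negMulLog p ≤ p * Real.log N + (1 / N - p) ∧
      (Real.negMulLog p = p * Real.log N + (1 / N - p) → p = 1 / N) := by
  have h : Real.negMulLog (N * p) = N * (Real.negMulLog p - p * Real.log N) := by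
    rw [Real.negMulLog_mul, Real.negMulLog]; ring
  have h1 : N * (p * Real.log N + (1 / N - p) - p * Real.log N) = 1 - N * p := by
    field_simp; ring
  constructor
  · have h2 := Real.negMulLog_le_one_sub_self (x := N * p) (by positivity)
    rw [h, ← h1] at h2
    have := le_of_mul_le_mul_left h2 hN
    linarith
  · intro heq
    by_contra hne
    have h2 := Real.negMulLog_lt_one_sub_self (x := N * p) (by positivity)
      (fun h' => hne (by field_simp; linarith))
    rw [h, ← h1, heq] at h2
    exact lt_irrefl _ h2

theorem partitionEntropy_le_log_card [IsProbabilityMeasure μ] {f : X → A} (hf : Measurable f) :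
    partitionEntropy μ f ≤ Real.log (Fintype.card A) := by
  have hs := sum_measureReal_fiber (μ := μ) hf
  have hA : Nonempty A := by
    by_contra h
    rw [not_nonempty_iff] at h
    simp at hs
  have hN : (0 : ℝ) < Fintype.card A := Nat.cast_pos.2 Fintype.card_pos
  calc partitionEntropy μ f
      ≤ ∑ a, (μ.real (f ⁻¹' {a}) * Real.log (Fintype.card A) +
          (1 / Fintype.card A - μ.real (f ⁻¹' {a}))) :=
        Finset.sum_le_sum fun a _ => (negMulLog_le_mul_log_add hN measureReal_nonneg).1
    _ = Real.log (Fintype.card A) := by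
        rw [Finset.sum_add_distrib, ← Finset.sum_mul, Finset.sum_sub_distrib, hs]
        simp [hN.ne']

theorem measureReal_fiber_eq_of_log_card_le [IsProbabilityMeasure μ] {f : X → A}
    (hf : Measurable f) (h : Real.log (Fintype.card A) ≤ partitionEntropy μ f) (a : A) :
    μ.real (f ⁻¹' {a}) = 1 / Fintype.card A := by
  have hs := sum_measureReal_fiber (μ := μ) hf
  have hN : (0 : ℝ) < Fintype.card A := Nat.cast_pos.2 (Fintype.card_pos_iff.2 ⟨a⟩)
  have heq : ∑ a, (μ.real (f ⁻¹' {a}) * Real.log (Fintype.card A) +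
          (1 / Fintype.card A - μ.real (f ⁻¹' {a}))) = Real.log (Fintype.card A) := by
    rw [Finset.sum_add_distrib, ← Finset.sum_mul, Finset.sum_sub_distrib, hs]
    simp [hN.ne']
  have hle : ∀ a ∈ Finset.univ, Real.negMulLog (μ.real (f ⁻¹' {a})) ≤
      μ.real (f ⁻¹' {a}) * Real.log (Fintype.card A) +
        (1 / Fintype.card A - μ.real (f ⁻¹' {a})) :=
    fun a _ => (negMulLog_le_mul_log_add hN measureReal_nonneg).1
  have := (Finset.sum_eq_sum_iff_of_le hle).1
    (le_antisymm (Finset.sum_le_sum hle) (heq.le.trans h)) a (Finset.mem_univ a)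
  exact (negMulLog_le_mul_log_add hN measureReal_nonneg).2 this

theorem partitionEntropy_nonneg [IsProbabilityMeasure μ] (f : X → A) :
    0 ≤ partitionEntropy μ f :=
  Finset.sum_nonneg fun _ _ => Real.negMulLog_nonneg measureReal_nonneg measureReal_le_one

theorem partitionEntropy_comp {T : X → X} (hT : MeasurePreserving T μ μ) {f : X → A}
    (hf : Measurable f) : partitionEntropy μ (fun x => f (T x)) = partitionEntropy μ f := by
  refine Finset.sum_congr rfl fun a _ => ?_
  congr 1
  exact hT.measureReal_preimage (hf MeasurableSet.of_discrete).nullMeasurableSet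

theorem measurable_joinedPartition {T : X → X} (hT : Measurable T) {f : X → A} (hf : Measurable f)
    (n : ℕ) : Measurable (joinedPartition T f n) :=
  measurable_pi_lambda _ fun i => hf.comp (hT.iterate i)

/-- A name of length `n + m` consists of the name of length `n` and the name of length `m` of the
point `T^[n] x`, whose law is the same by invariance. -/
theorem subadditive_partitionEntropy_joinedPartition [IsProbabilityMeasure μ] {T : X → X}
    (hT : MeasurePreserving T μ μ) {f : X → A} (hf : Measurable f) :
    Subadditive fun n => partitionEntropy μ (joinedPartition T f n) := by
  intro n m
  have hn := measurable_joinedPartition hT.measurable hf n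
  have hm := measurable_joinedPartition hT.measurable hf m
  have hm' : Measurable fun x => joinedPartition T f m (T^[n] x) :=
    hm.comp (hT.measurable.iterate n)
  beta_reduce
  rw [← partitionEntropy_comp (hT.iterate n) hm]
  refine le_trans (partitionEntropy_le_of_factorsThrough (hn.prodMk hm') ?_)
    (partitionEntropy_prod_le hn hm')
  intro x y hxy
  simp only [Prod.mk.injEq] at hxy
  funext i
  rcases lt_or_ge (i : ℕ) n with h | h
  · exact congrFun hxy.1 ⟨i, h⟩
  · have := congrFun hxy.2 ⟨i - n, by omega⟩
    simpa only [joinedPartition, ← Function.iterate_add_apply, Nat.sub_add_cancel h] using this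

theorem partitionEntropy_joinedPartition_le [IsProbabilityMeasure μ] {T : X → X}
    (hT : MeasurePreserving T μ μ) {f : X → A} (hf : Measurable f) (n : ℕ) :
    partitionEntropy μ (joinedPartition T f n) ≤ n * partitionEntropy μ f := by
  have h0 : partitionEntropy μ (joinedPartition T f 0) ≤ 0 := by
    refine (partitionEntropy_le_log_card (measurable_joinedPartition hT.measurable hf 0)).trans ?_
    simp
  have h1 : partitionEntropy μ (joinedPartition T f 1) ≤ partitionEntropy μ f :=
    partitionEntropy_le_of_factorsThrough hf fun x y hxy => by
      funext i
      obtain rfl := Fin.fin_one_eq_zero i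
      exact hxy
  have := (subadditive_partitionEntropy_joinedPartition hT hf).apply_mul_add_le n 1 0
  rw [mul_one, add_zero] at this
  have h2 := mul_le_mul_of_nonneg_left h1 (Nat.cast_nonneg (α := ℝ) n)
  linarith

end Entropy

/-! ### Approximation by grid partitions and the upper bound for the entropy -/

/-- By regularity choose a compact `K` and an open `U` with `K ⊆ A ⊆ U`. For a fine mesh the cells
meeting `K` stay inside `U`; take `B` to be these cells. -/
theorem exists_gridCell_approx (μ : Measure unitSquare) [IsFiniteMeasure μ] {A : Set unitSquare}
    (hA : MeasurableSet A) {ε : ℝ} (hε : 0 < ε) :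
    ∃ m₀ : ℕ, ∀ m > m₀, ∃ B : Set (Fin (m + 1) × Fin (m + 1)),
      μ.real (A ∆ (gridCell m ⁻¹' B)) ≤ ε := by
  have : CompactSpace unitSquare := isCompact_iff_compactSpace.1 (isCompact_Icc.prod isCompact_Icc)
  have hε' : ENNReal.ofReal (ε / 2) ≠ 0 := by
    rw [Ne, ENNReal.ofReal_eq_zero, not_le]; positivity
  obtain ⟨K, hKA, hK, hAK⟩ := hA.exists_isCompact_sdiff_lt (measure_ne_top μ A) hε'
  obtain ⟨U, hAU, hU, -, hUA⟩ := hA.exists_isOpen_sdiff_lt (measure_ne_top μ A) hε'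
  obtain ⟨δ, hδ, hδU⟩ := hK.exists_thickening_subset_open hU (hKA.trans hAU)
  obtain ⟨m₀, hm₀⟩ := exists_nat_one_div_lt hδ
  refine ⟨m₀, fun m hm => ⟨gridCell m '' K, ?_⟩⟩
  have hm' : (1 : ℝ) / m < δ := by
    refine lt_of_le_of_lt ?_ hm₀
    exact one_div_le_one_div_of_le (by positivity) (by exact_mod_cast hm)
  have hKB : K ⊆ gridCell m ⁻¹' (gridCell m '' K) := Set.subset_preimage_image _ _
  have hBU : gridCell m ⁻¹' (gridCell m '' K) ⊆ U := by
    rintro p ⟨q, hq, hqp⟩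
    refine hδU (Metric.mem_thickening_iff.2 ⟨q, hq, ?_⟩)
    exact (dist_lt_of_gridCell_eq (by omega) hqp.symm).trans hm'
  have hsub : A ∆ (gridCell m ⁻¹' (gridCell m '' K)) ⊆ (A \ K) ∪ (U \ A) := by
    rintro p (⟨h1, h2⟩ | ⟨h1, h2⟩)
    · exact Or.inl ⟨h1, fun h => h2 (hKB h)⟩
    · exact Or.inr ⟨hBU h1, h2⟩
  have h1 : μ.real (A \ K) ≤ ε / 2 := ENNReal.toReal_le_of_le_ofReal (by positivity) hAK.le
  have h2 : μ.real (U \ A) ≤ ε / 2 := ENNReal.toReal_le_of_le_ofReal (by positivity) hUA.le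
  calc μ.real (A ∆ (gridCell m ⁻¹' (gridCell m '' K))) ≤ μ.real ((A \ K) ∪ (U \ A)) :=
        measureReal_mono hsub
    _ ≤ μ.real (A \ K) + μ.real (U \ A) := measureReal_union_le _ _
    _ ≤ ε := by linarith

theorem exists_gridCell_factor_approx (μ : Measure unitSquare) [IsFiniteMeasure μ] {k : ℕ}
    {η : unitSquare → Fin k} (hη : Measurable η) {ε : ℝ} (hε : 0 < ε) :
    ∃ m > 0, ∃ c : Fin (m + 1) × Fin (m + 1) → Fin k,
      μ.real {p | η p ≠ c (gridCell m p)} ≤ ε := by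
  classical
  have hk : 0 < k := Fin.pos (η ⟨(0, 0), by simp⟩)
  have hk' : (0 : ℝ) < k := Nat.cast_pos.2 hk
  choose m₀ hm₀ using fun i => exists_gridCell_approx μ (hη (measurableSet_singleton i))
    (div_pos hε hk')
  let m := Finset.univ.sup m₀ + 1
  have hm : ∀ i, m > m₀ i := fun i => Nat.lt_succ_of_le (Finset.le_sup (Finset.mem_univ i))
  choose B hB using fun i => hm₀ i m (hm i)
  -- The sets `B i` may overlap or miss cells. Off the symmetric differences exactly one of them
  -- contains the cell, so the arbitrary choice is harmless.
  refine ⟨m, Nat.succ_pos _, fun g => if h : ∃ i, g ∈ B i then h.choose else ⟨0, hk⟩, ?_⟩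
  calc _ ≤ μ.real (⋃ i ∈ Finset.univ, (η ⁻¹' {i}) ∆ (gridCell m ⁻¹' B i)) := by
        refine measureReal_mono ?_ (measure_ne_top _ _)
        intro p hp
        by_contra hnot
        simp only [Finset.mem_univ, Set.iUnion_true, Set.mem_iUnion, not_exists] at hnot
        have hiff : ∀ i, η p = i ↔ gridCell m p ∈ B i := by
          intro i
          have := hnot i
          rw [Set.mem_symmDiff] at this
          simp only [Set.mem_preimage, Set.mem_singleton_iff] at this
          tauto
        have hex : ∃ i, gridCell m p ∈ B i := ⟨η p, (hiff _).1 rfl⟩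
        refine hp ?_
        simp only [dif_pos hex]
        exact (hiff _).2 hex.choose_spec
    _ ≤ ∑ i : Fin k, μ.real ((η ⁻¹' {i}) ∆ (gridCell m ⁻¹' B i)) :=
        measureReal_biUnion_finset_le _ _
    _ ≤ ∑ i : Fin k, ε / k := Finset.sum_le_sum fun i _ => hB i
    _ = ε := by simp; field_simp

/-- The entropy of the partition which records where, and how, two maps differ is small if the
maps differ with small probability only. -/
theorem exists_partitionEntropy_disagreement_le (k : ℕ) {ε : ℝ} (hε : 0 < ε) :
    ∃ δ > 0, ∀ {X : Type} [MeasurableSpace X] (μ : Measure X) [IsProbabilityMeasure μ]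
      (e : X → Fin (k + 1)), Measurable e → μ.real {x | e x ≠ 0} ≤ δ →
        partitionEntropy μ e ≤ ε := by
  have hk : (0 : ℝ) < k + 1 := by positivity
  have hε' : 0 < ε / (k + 1) := by positivity
  have h0 : ∀ᶠ t in 𝓝 (0 : ℝ), Real.negMulLog t < ε / (k + 1) :=
    Real.continuous_negMulLog.continuousAt.eventually_lt continuousAt_const (by simpa)
  have h1 : ∀ᶠ t in 𝓝 (0 : ℝ), Real.negMulLog (1 - t) < ε / (k + 1) :=
    ContinuousAt.eventually_lt (by fun_prop) continuousAt_const (by simpa)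
  obtain ⟨δ, hδ, hball⟩ := Metric.eventually_nhds_iff.1 (h0.and h1)
  refine ⟨δ / 2, by positivity, fun {X} _ μ _ e he hμ => ?_⟩
  have hsmall : ∀ t : ℝ, 0 ≤ t → t ≤ δ / 2 → dist t 0 < δ := by
    intro t ht ht'
    rw [Real.dist_eq, sub_zero, abs_of_nonneg ht]
    linarith
  rw [partitionEntropy, Fin.sum_univ_succ]
  have hnone : Real.negMulLog (μ.real (e ⁻¹' {0})) ≤ ε / (k + 1) := by
    have : μ.real (e ⁻¹' {0}) = 1 - μ.real {x | e x ≠ 0} := by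
      have h := probReal_compl_eq_one_sub (μ := μ) (he (measurableSet_singleton 0))
      rw [show {x | e x ≠ 0} = (e ⁻¹' {0})ᶜ from rfl, h]
      ring
    rw [this]
    exact (hball (hsmall _ measureReal_nonneg hμ)).2.le
  have hsome : ∀ i : Fin k, Real.negMulLog (μ.real (e ⁻¹' {i.succ})) ≤ ε / (k + 1) := by
    intro i
    refine (hball (hsmall _ measureReal_nonneg (le_trans (measureReal_mono ?_) hμ))).1.le
    intro x hx
    simp only [Set.mem_preimage, Set.mem_singleton_iff] at hx
    simp [hx]
  calc _ ≤ ε / (k + 1) + ∑ i : Fin k, ε / (k + 1) :=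
        add_le_add hnone (Finset.sum_le_sum fun i _ => hsome i)
    _ = ε := by simp; field_simp; ring

theorem card_code (m n : ℕ) : Fintype.card (Code m n) =
    (n + 1) * ((n + 1) * 49) * (n * (m + 1) * 2 + 1) ^ 3 := by
  simp [Code]
  rfl

theorem tendsto_log_card_code_div (m : ℕ) :
    Tendsto (fun n : ℕ => Real.log (Fintype.card (Code m n)) / n) atTop (𝓝 0) := by
  -- The number of codes is at most `C (2n)^5`: two times and a cubic number of sign patterns give
  -- the degree `5`, and two of the seven pieces give `49`.
  set C : ℝ := 49 * (2 * (m + 1) + 1) ^ 3 with hC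
  have hCpos : 0 < C := by positivity
  have hlog : Tendsto (fun n : ℕ => Real.log n / n) atTop (𝓝 0) := by
    have := (Real.isLittleO_log_id_atTop.tendsto_div_nhds_zero).comp tendsto_natCast_atTop_atTop
    exact this
  have hbound : Tendsto (fun n : ℕ => (Real.log C + 5 * Real.log 2) / n + 5 * (Real.log n / n))
      atTop (𝓝 0) := by
    have := (tendsto_const_div_atTop_nhds_zero_nat (Real.log C + 5 * Real.log 2)).add
      (hlog.const_mul 5)
    simpa using this
  refine squeeze_zero' (Eventually.of_forall fun n => ?_) ?_ hbound
  · exact div_nonneg (Real.log_natCast_nonneg _) n.cast_nonneg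
  · filter_upwards [eventually_gt_atTop 0] with n hn
    have hn' : (1 : ℝ) ≤ n := by exact_mod_cast hn
    have hcard : (Fintype.card (Code m n) : ℝ) ≤ C * (2 * n) ^ 5 := by
      rw [card_code, hC]
      push_cast
      have h1 : (n : ℝ) + 1 ≤ 2 * n := by linarith
      have h2 : (n : ℝ) * (m + 1) * 2 + 1 ≤ (2 * (m + 1) + 1) * (2 * n) := by
        nlinarith [mul_nonneg (n.cast_nonneg (α := ℝ)) (m.cast_nonneg (α := ℝ))]
      calc ((n : ℝ) + 1) * ((n + 1) * 49) * (n * (m + 1) * 2 + 1) ^ 3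
          ≤ (2 * n) * ((2 * n) * 49) * ((2 * (m + 1) + 1) * (2 * n)) ^ 3 := by gcongr
        _ = _ := by ring
    have hpos : (0 : ℝ) < Fintype.card (Code m n) := by
      rw [card_code]; positivity
    have hn0 : (0 : ℝ) < n := by linarith
    have h3 := Real.log_le_log hpos hcard
    rw [Real.log_mul hCpos.ne' (by positivity), Real.log_pow, Real.log_mul two_ne_zero hn0.ne'] at h3
    push_cast at h3
    rw [← mul_div_assoc, ← add_div]
    gcongr
    linarith

/-- The entropy of any finite partition is bounded by that of the digits. -/
theorem partitionEntropy_joinedPartition_le_digit {μ : Measure unitSquare}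
    [IsProbabilityMeasure μ] (hμ : MeasurePreserving coneMap μ μ) {k : ℕ}
    {η : unitSquare → Fin k} (hη : Measurable η) {ε : ℝ} (hε : 0 < ε) :
    ∃ m : ℕ, ∀ n : ℕ, partitionEntropy μ (joinedPartition coneMap η n) ≤
      partitionEntropy μ (joinedPartition coneMap digit n) +
        Real.log (Fintype.card (Code m n)) + n * ε := by
  classical
  obtain ⟨δ, hδ, hdis⟩ := exists_partitionEntropy_disagreement_le k hε
  obtain ⟨m, -, c, hc⟩ := exists_gridCell_factor_approx μ hη hδ
  refine ⟨m, fun n => ?_⟩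
  -- `0` means that the grid predicts `η` correctly; otherwise `e` records the true value. Grid name
  -- and `e`-name together recover the `η`-name, and `e` has entropy at most `ε`.
  let e : unitSquare → Fin (k + 1) := fun p => if η p = c (gridCell m p) then 0 else (η p).succ
  have he : Measurable e := measurable_of_factorsThrough
    (W := fun p => (η p, gridCell m p)) (hη.prodMk (measurable_gridCell m)) fun x y h => by
      simp only [Prod.mk.injEq] at h
      simp only [e, h.1, h.2]
  have he' : partitionEntropy μ e ≤ ε := by
    refine hdis μ e he (le_trans (measureReal_mono fun p hp => ?_) hc)
    intro h
    exact hp (if_pos h)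
  obtain ⟨code, hcode, hdet⟩ := exists_code m n
  have hT := hμ.measurable
  have h1 := measurable_joinedPartition hT measurable_digit n
  have h2 := measurable_joinedPartition hT he n
  have h3 : partitionEntropy μ (joinedPartition coneMap η n) ≤ partitionEntropy μ
      (fun p => ((joinedPartition coneMap digit n p, code p), joinedPartition coneMap e n p)) := by
    refine partitionEntropy_le_of_factorsThrough ((h1.prodMk hcode).prodMk h2) fun x y h => ?_
    simp only [Prod.mk.injEq] at h
    have hg := hdet x y h.1.1 h.1.2
    funext i
    have hgi : gridCell m (coneMap^[i] x) = gridCell m (coneMap^[i] y) := congrFun hg i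
    have hei : e (coneMap^[i] x) = e (coneMap^[i] y) := congrFun h.2 i
    simp only [joinedPartition]
    simp only [e] at hei
    grind
  refine h3.trans ((partitionEntropy_prod_le (h1.prodMk hcode) h2).trans (add_le_add ?_ ?_))
  · exact (partitionEntropy_prod_le h1 hcode).trans
      (add_le_add_right (partitionEntropy_le_log_card hcode) _)
  · exact (partitionEntropy_joinedPartition_le hμ he n).trans (by gcongr)

/-- The metric entropy is bounded by the entropy of the digits. -/
theorem metricEntropy_le {μ : Measure unitSquare} (hμ : IsInvariantProbability coneMap μ) {N : ℕ}
    (hN : N ≠ 0) :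
    metricEntropy coneMap μ ≤
      ((partitionEntropy μ (joinedPartition coneMap digit N) / N : ℝ) : EReal) := by
  obtain ⟨_, hμ⟩ := hμ
  have hsub := subadditive_partitionEntropy_joinedPartition hμ measurable_digit
  have hbdd : BddBelow (Set.range fun n : ℕ =>
      partitionEntropy μ (joinedPartition coneMap digit n) / n) := by
    refine ⟨0, ?_⟩
    rintro _ ⟨n, rfl⟩
    exact div_nonneg (partitionEntropy_nonneg _) n.cast_nonneg
  refine le_trans (iSup_le fun k => iSup_le fun η => iSup_le fun hη => ?_)
    (EReal.coe_le_coe_iff.2 (hsub.lim_le_div hbdd hN))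
  refine EReal.le_of_forall_lt_iff_le.1 fun z hz => ?_
  rw [EReal.coe_lt_coe_iff] at hz
  -- The approximation error uses half of the room between the limiting digit entropy and `z`; the
  -- code term vanishes after division by `n`.
  obtain ⟨m, hm⟩ := partitionEntropy_joinedPartition_le_digit hμ hη
    (ε := (z - hsub.lim) / 2) (by linarith)
  have hlim := ((hsub.tendsto_lim hbdd).add (tendsto_log_card_code_div m)).add_const
    ((z - hsub.lim) / 2)
  refine limsup_le_of_le (by isBoundedDefault) ?_
  filter_upwards [hlim.eventually (gt_mem_nhds (show _ < z by linarith)), eventually_gt_atTop 0]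
    with n hn hn0
  rw [EReal.coe_le_coe_iff]
  have hn0' : (0 : ℝ) < n := by exact_mod_cast hn0
  refine le_trans ?_ hn.le
  rw [← add_div, ← sub_le_iff_le_add, ← mul_div_cancel_left₀ ((z - hsub.lim) / 2) hn0'.ne',
    ← sub_div]
  gcongr
  have := hm n
  linarith

theorem partitionEntropy_digit_le (μ : Measure unitSquare) [IsProbabilityMeasure μ] (n : ℕ) :
    partitionEntropy μ (joinedPartition coneMap digit n) ≤ n * Real.log 2 := by
  refine (partitionEntropy_le_log_card (measurable_joinedPartition
    continuous_coneMap.measurable measurable_digit n)).trans ?_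
  simp

theorem metricEntropy_le_log_two {μ : Measure unitSquare}
    (hμ : IsInvariantProbability coneMap μ) :
    metricEntropy coneMap μ ≤ ((Real.log 2 : ℝ) : EReal) := by
  have := hμ.1
  refine (metricEntropy_le hμ one_ne_zero).trans (EReal.coe_le_coe_iff.2 ?_)
  simpa using partitionEntropy_digit_le μ 1

/-! ### Absence of measures of maximal entropy -/

theorem coneMap_snd_of_digit_eq_zero {p : unitSquare} (h : digit p = 0) :
    (coneMap p).1.2 = p.1.2 / 2 := by
  rw [coneMap_eq_branch, digit_eq_zero_iff.1 h]
  simp [branch]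
  ring

theorem coneMap_snd_le (p : unitSquare) : (coneMap p).1.2 ≤ 2 * p.1.2 :=
  (min_le_right _ _).trans (min_le_left _ _)

/-- A zero halves the height and a one at most doubles it, so `a` ones among `n` digits leave height
at most `2 ^ (2a - n)`. -/
theorem iterate_snd_mul_le (p : unitSquare) (n : ℕ) : (coneMap^[n] p).1.2 * 2 ^ n ≤
    4 ^ ((Finset.range n).filter fun i => digit (coneMap^[i] p) = 1).card := by
  induction n with
  | zero => simpa using p.2.2.2
  | succ n ih =>
    rw [Function.iterate_succ_apply', Finset.range_add_one, Finset.filter_insert]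
    split_ifs with h
    · rw [Finset.card_insert_of_notMem (by simp)]
      have := mul_le_mul_of_nonneg_right (coneMap_snd_le (coneMap^[n] p))
        (show (0 : ℝ) ≤ 2 ^ (n + 1) by positivity)
      refine this.trans ?_
      rw [pow_succ, pow_succ]
      linarith
    · have h0 : digit (coneMap^[n] p) = 0 := by omega
      rw [coneMap_snd_of_digit_eq_zero h0, pow_succ]
      linarith

/-- Gives `centralBinom j / 4 ^ j ≤ 1 / √(2j + 1)`. The induction step reduces to `(2j + 1)(2j + 3)
≤ 4(j + 1)²`. -/
theorem centralBinom_sq_mul_le (j : ℕ) : j.centralBinom ^ 2 * (2 * j + 1) ≤ 16 ^ j := by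
  induction j with
  | zero => simp
  | succ j ih =>
    have h := Nat.succ_mul_centralBinom_succ j
    refine le_of_mul_le_mul_left ?_ (pow_pos j.succ_pos 2)
    calc (j + 1) ^ 2 * ((j + 1).centralBinom ^ 2 * (2 * (j + 1) + 1))
        = ((j + 1) * (j + 1).centralBinom) ^ 2 * (2 * j + 3) := by ring
      _ = (j.centralBinom ^ 2 * (2 * j + 1)) * (4 * ((2 * j + 1) * (2 * j + 3))) := by rw [h]; ring
      _ ≤ 16 ^ j * (4 * (4 * (j + 1) ^ 2)) :=
          Nat.mul_le_mul ih (Nat.mul_le_mul_left 4 (by nlinarith))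
      _ = (j + 1) ^ 2 * 16 ^ (j + 1) := by ring

/-- Complementation matches sets with at most `j - K` elements with those having at least `j + K`;
the fewer than `2K` middle sizes, if any, each contribute at most a central binomial coefficient. -/
theorem four_pow_le_card_low (j K : ℕ) : 4 ^ j ≤
    2 * ((Finset.univ : Finset (Finset (Fin (2 * j)))).filter fun s => s.card + K ≤ j).card +
      2 * K * j.centralBinom := by
  classical
  set low := (Finset.univ : Finset (Finset (Fin (2 * j)))).filter fun s => s.card + K ≤ j
  set high := (Finset.univ : Finset (Finset (Fin (2 * j)))).filter fun s => j + K ≤ s.card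
  set mid := (Finset.Ico (j + 1 - K) (j + K)).biUnion fun i =>
    Finset.powersetCard i (Finset.univ : Finset (Fin (2 * j)))
  have hhigh : high.card = low.card := by
    refine Finset.card_nbij' (fun s => sᶜ) (fun s => sᶜ) ?_ ?_ ?_ ?_
    · intro s hs
      have := s.card_le_univ
      simp only [high, low, Finset.coe_filter, Finset.mem_univ, true_and, Set.mem_ofPred_eq,
        Finset.card_compl, Fintype.card_fin] at hs this ⊢
      omega
    · intro s hs
      have := s.card_le_univ
      simp only [high, low, Finset.coe_filter, Finset.mem_univ, true_and, Set.mem_ofPred_eq,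
        Finset.card_compl, Fintype.card_fin] at hs this ⊢
      omega
    · intro s _; simp
    · intro s _; simp
  have hmid : mid.card ≤ 2 * K * j.centralBinom := by
    refine Finset.card_biUnion_le.trans ?_
    calc _ ≤ ∑ i ∈ Finset.Ico (j + 1 - K) (j + K), j.centralBinom := by
          refine Finset.sum_le_sum fun i _ => ?_
          rw [Finset.card_powersetCard, Finset.card_univ, Fintype.card_fin]
          exact Nat.choose_le_centralBinom i j
      _ ≤ 2 * K * j.centralBinom := by
          rw [Finset.sum_const, smul_eq_mul, Nat.card_Ico]
          exact Nat.mul_le_mul_right _ (by omega)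
  have huniv : (Finset.univ : Finset (Finset (Fin (2 * j)))) ⊆ low ∪ high ∪ mid := by
    intro s _
    simp only [low, high, mid, Finset.mem_union, Finset.mem_filter, Finset.mem_univ, true_and,
      Finset.mem_biUnion, Finset.mem_Ico, Finset.mem_powersetCard, Finset.subset_univ]
    by_cases h1 : s.card + K ≤ j
    · exact Or.inl (Or.inl h1)
    by_cases h2 : j + K ≤ s.card
    · exact Or.inl (Or.inr h2)
    · exact Or.inr ⟨s.card, by omega, rfl⟩
  have h := (Finset.card_le_card huniv).trans ((Finset.card_union_le _ _).trans
    (Nat.add_le_add_right (Finset.card_union_le _ _) _))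
  rw [Finset.card_univ, Fintype.card_finset, Fintype.card_fin, pow_mul, hhigh] at h
  norm_num at h
  omega

/-- The word with ones exactly at the positions in `s`. -/
def wordOfFinset {n : ℕ} (s : Finset (Fin n)) (i : Fin n) : Fin 2 := if i ∈ s then 1 else 0

theorem wordOfFinset_injective {n : ℕ} : Function.Injective (wordOfFinset (n := n)) := by
  intro s t h
  ext i
  have := congrFun h i
  unfold wordOfFinset at this
  split_ifs at this <;> simp_all

theorem card_digit_eq_one_of_word {n : ℕ} {s : Finset (Fin n)} {p : unitSquare}
    (h : joinedPartition coneMap digit n p = wordOfFinset s) :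
    ((Finset.range n).filter fun i => digit (coneMap^[i] p) = 1).card = s.card := by
  have : ((Finset.range n).filter fun i => digit (coneMap^[i] p) = 1) =
      s.map Fin.valEmbedding := by
    ext i
    simp only [Finset.mem_filter, Finset.mem_range, Finset.mem_map, Fin.valEmbedding_apply]
    constructor
    · rintro ⟨hi, hd⟩
      refine ⟨⟨i, hi⟩, ?_, rfl⟩
      have := congrFun h ⟨i, hi⟩
      simp only [joinedPartition, hd, wordOfFinset] at this
      by_contra hs
      simp [hs] at this
    · rintro ⟨k, hk, rfl⟩
      refine ⟨k.2, ?_⟩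
      have := congrFun h k
      simpa only [joinedPartition, wordOfFinset, hk, if_true] using this
  rw [this, Finset.card_map]

section Maximal

variable {μ : Measure unitSquare} [IsProbabilityMeasure μ]

/-- At most `j - K` ones in `2j` steps force the final height down to `4⁻ᴷ`. Invariance transfers
the mass of these words to the measure of low heights. -/
theorem half_sub_le_measure_low (hμ : MeasurePreserving coneMap μ μ)
    (hunif : ∀ n, ∀ w : Fin n → Fin 2,
      μ.real (joinedPartition coneMap digit n ⁻¹' {w}) = 1 / 2 ^ n) (j K : ℕ) :
    1 / 2 - K * (j.centralBinom / 4 ^ j : ℝ) ≤ μ.real {p | p.1.2 * 4 ^ K ≤ 1} := by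
  classical
  set low := (Finset.univ : Finset (Finset (Fin (2 * j)))).filter fun s => s.card + K ≤ j with hlow
  have hset : MeasurableSet {p : unitSquare | p.1.2 * 4 ^ K ≤ 1} :=
    measurableSet_le (by fun_prop) (by fun_prop)
  have hmeas := measurable_joinedPartition continuous_coneMap.measurable measurable_digit (2 * j)
  have hinv : μ.real (coneMap^[2 * j] ⁻¹' {p | p.1.2 * 4 ^ K ≤ 1}) =
      μ.real {p | p.1.2 * 4 ^ K ≤ 1} :=
    (hμ.iterate (2 * j)).measureReal_preimage hset.nullMeasurableSet
  have hsub : joinedPartition coneMap digit (2 * j) ⁻¹' (low.image wordOfFinset) ⊆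
      coneMap^[2 * j] ⁻¹' {p | p.1.2 * 4 ^ K ≤ 1} := by
    intro p hp
    simp only [Finset.coe_image, Set.mem_preimage, Set.mem_image, Finset.mem_coe] at hp
    obtain ⟨s, hs, hsp⟩ := hp
    have h1 := iterate_snd_mul_le p (2 * j)
    rw [card_digit_eq_one_of_word hsp.symm, pow_mul] at h1
    norm_num at h1
    have h2 : s.card + K ≤ j := (Finset.mem_filter.1 hs).2
    have h3 : (4 : ℝ) ^ s.card * 4 ^ K ≤ 4 ^ j := by
      rw [← pow_add]; exact pow_le_pow_right₀ (by norm_num) h2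
    have h4 : (0 : ℝ) < 4 ^ j := by positivity
    have h5 := mul_le_mul_of_nonneg_right h1 (show (0 : ℝ) ≤ 4 ^ K by positivity)
    simp only [Set.mem_preimage, Set.mem_ofPred_eq]
    refine le_of_mul_le_mul_right ?_ h4
    linarith
  have hcount : μ.real (joinedPartition coneMap digit (2 * j) ⁻¹' (low.image wordOfFinset)) =
      low.card / 4 ^ j := by
    rw [← sum_measureReal_preimage_singleton _ (fun b _ => hmeas MeasurableSet.of_discrete)]
    simp only [hunif]
    rw [Finset.sum_const, Finset.card_image_of_injective _ wordOfFinset_injective, pow_mul]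
    norm_num
    rfl
  have h := four_pow_le_card_low j K
  rw [← hlow] at h
  have h' : (4 : ℝ) ^ j ≤ 2 * low.card + 2 * K * j.centralBinom := by exact_mod_cast h
  have hpos : (0 : ℝ) < 4 ^ j := by positivity
  calc 1 / 2 - K * (j.centralBinom / 4 ^ j : ℝ) ≤ low.card / 4 ^ j := by
        rw [le_div_iff₀ hpos, sub_mul, mul_assoc, div_mul_cancel₀ _ hpos.ne']
        linarith
    _ ≤ μ.real (coneMap^[2 * j] ⁻¹' {p | p.1.2 * 4 ^ K ≤ 1}) := by
        rw [← hcount]; exact measureReal_mono hsub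
    _ = _ := hinv

theorem tendsto_centralBinom_div_four_pow :
    Tendsto (fun j : ℕ => (j.centralBinom / 4 ^ j : ℝ)) atTop (𝓝 0) := by
  have hsq : Tendsto (fun j : ℕ => Real.sqrt (1 / ((j : ℝ) + 1))) atTop (𝓝 0) := by
    have := (Real.continuous_sqrt.tendsto 0).comp tendsto_one_div_add_atTop_nhds_zero_nat
    rw [Real.sqrt_zero] at this
    exact this
  refine squeeze_zero (fun j => by positivity) (fun j => ?_) hsq
  refine Real.le_sqrt_of_sq_le ?_
  rw [div_pow, ← pow_mul, mul_comm j 2, pow_mul, div_le_div_iff₀ (by positivity) (by positivity)]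
  have h : (j.centralBinom : ℝ) ^ 2 * (2 * j + 1) ≤ 16 ^ j := by
    exact_mod_cast centralBinom_sq_mul_le j
  norm_num
  refine le_trans ?_ h
  gcongr
  have : (0 : ℝ) ≤ j := j.cast_nonneg
  linarith

/-- Let `j → ∞` for fixed `K`, so that the middle words become negligible, then let `K → ∞`. -/
theorem half_le_measure_snd_eq_zero (hμ : MeasurePreserving coneMap μ μ)
    (hunif : ∀ n, ∀ w : Fin n → Fin 2,
      μ.real (joinedPartition coneMap digit n ⁻¹' {w}) = 1 / 2 ^ n) :
    1 / 2 ≤ μ.real {p | p.1.2 = 0} := by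
  have hK : ∀ K : ℕ, 1 / 2 ≤ μ.real {p : unitSquare | p.1.2 * 4 ^ K ≤ 1} := by
    intro K
    have hlim : Tendsto (fun j : ℕ => 1 / 2 - K * (j.centralBinom / 4 ^ j : ℝ)) atTop
        (𝓝 (1 / 2)) := by
      have := (tendsto_centralBinom_div_four_pow.const_mul (K : ℝ)).const_sub (1 / 2)
      rwa [mul_zero, sub_zero] at this
    exact le_of_tendsto' hlim fun j => half_sub_le_measure_low hμ hunif j K
  have hinter : {p : unitSquare | p.1.2 = 0} = ⋂ K : ℕ, {p : unitSquare | p.1.2 * 4 ^ K ≤ 1} := by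
    ext p
    simp only [Set.mem_ofPred_eq, Set.mem_iInter]
    constructor
    · intro h K; simp [h]
    · intro h
      by_contra hne
      have hpos : 0 < p.1.2 := lt_of_le_of_ne p.2.2.1 (Ne.symm hne)
      obtain ⟨K, hK⟩ := pow_unbounded_of_one_lt (1 / p.1.2) (show (1 : ℝ) < 4 by norm_num)
      rw [div_lt_iff₀ hpos] at hK
      linarith [h K]
  have hlim := tendsto_measure_iInter_atTop (μ := μ)
    (s := fun K : ℕ => {p : unitSquare | p.1.2 * 4 ^ K ≤ 1})
    (fun K => (measurableSet_le (by fun_prop) (by fun_prop)).nullMeasurableSet)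
    (fun K L hKL p hp => by
      refine le_trans (mul_le_mul_of_nonneg_left ?_ p.2.2.1) (Set.mem_ofPred_eq ▸ hp)
      exact pow_le_pow_right₀ (by norm_num) hKL)
    ⟨0, measure_ne_top _ _⟩
  rw [← hinter] at hlim
  exact ge_of_tendsto' ((ENNReal.tendsto_toReal (measure_ne_top _ _)).comp hlim) hK

theorem digit_iterate_succ_of_snd_eq_zero {p : unitSquare} (h : p.1.2 = 0) (n : ℕ) :
    digit (coneMap^[n + 1] p) = 0 := by
  rw [digit_eq_zero_iff]
  refine piece_of_fst_eq_zero (iterate_fst_eq_zero_of_le (i := 1) (by omega) ?_)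
  have hx : 0 ≤ p.1.1 := p.2.1.1
  refine max_eq_left ((min_le_right _ _).trans ((min_le_left _ _).trans ?_))
  rw [h]
  linarith

theorem not_log_two_le_metricEntropy {μ : Measure unitSquare}
    (hμ : IsInvariantProbability coneMap μ) :
    ¬ ((Real.log 2 : ℝ) : EReal) ≤ metricEntropy coneMap μ := by
  intro hlog
  obtain ⟨hprob, hT⟩ := id hμ
  have hmeas := measurable_joinedPartition continuous_coneMap.measurable measurable_digit
  have hunif : ∀ n, ∀ w : Fin n → Fin 2,
      μ.real (joinedPartition coneMap digit n ⁻¹' {w}) = 1 / 2 ^ n := by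
    intro n w
    -- `metricEntropy_le` holds for every word length, so entropy `log 2` forces equality in the
    -- cardinality bound at every length.
    have := measureReal_fiber_eq_of_log_card_le (μ := μ) (hmeas n) ?_ w
    · simpa using this
    rcases eq_or_ne n 0 with rfl | hn
    · simpa using partitionEntropy_nonneg _
    have h := EReal.coe_le_coe_iff.1 (hlog.trans (metricEntropy_le hμ hn))
    rw [le_div_iff₀ (by positivity)] at h
    simpa [mul_comm] using h
  have h1 := half_le_measure_snd_eq_zero hT hunif
  -- The right-hand side is `1/4` by invariance and uniformity, against a left-hand side of at least
  -- `1/2`.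
  have h2 : μ.real {p | p.1.2 = 0} ≤
      μ.real (coneMap ⁻¹' (joinedPartition coneMap digit 2 ⁻¹' {fun _ => 0})) := by
    refine measureReal_mono fun p hp => ?_
    funext i
    simp only [joinedPartition, ← Function.iterate_succ_apply]
    exact digit_iterate_succ_of_snd_eq_zero hp i
  rw [hT.measureReal_preimage (hmeas 2 (measurableSet_singleton _)).nullMeasurableSet,
    hunif] at h2
  norm_num at h2
  linarith

end Maximal

/-! ### Points with given digits -/

/-- The shift on sequences of digits. -/
def shift (w : ℕ → Fin 2) (i : ℕ) : Fin 2 := w (i + 1)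

/-- The evolution of `k` for the heights `2⁻ᵏ`. -/
def nextLevel (k : ℕ) (b : Fin 2) : ℕ := if b = 0 then k + 1 else k - 1

/-- The inverse branches of the action on rays, at height `2⁻ᵏ`. -/
def inverseBranch (k : ℕ) (b : Fin 2) (t : ℝ) : ℝ :=
  if b = 0 then t / 5 else if k = 0 then 1 - t / 10 else 1 - t / 5

theorem inverseBranch_mem {k : ℕ} {b : Fin 2} {t : ℝ} (ht : t ∈ Set.Icc (0 : ℝ) 1) :
    inverseBranch k b t ∈ Set.Icc (0 : ℝ) 1 := by
  obtain ⟨h0, h1⟩ := ht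
  unfold inverseBranch
  split_ifs <;> constructor <;> linarith

theorem abs_inverseBranch_sub_le (k : ℕ) (b : Fin 2) (t u : ℝ) :
    |inverseBranch k b t - inverseBranch k b u| ≤ |t - u| * (1 / 5) := by
  have h := abs_nonneg (t - u)
  unfold inverseBranch
  split_ifs
  · rw [← sub_div, abs_div, abs_of_pos (show (0 : ℝ) < 5 by norm_num)]
    linarith
  · rw [sub_sub_sub_cancel_left, ← sub_div, abs_div, abs_of_pos (show (0 : ℝ) < 10 by norm_num),
      abs_sub_comm]
    linarith
  · rw [sub_sub_sub_cancel_left, ← sub_div, abs_div, abs_of_pos (show (0 : ℝ) < 5 by norm_num),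
      abs_sub_comm]
    linarith

theorem continuous_inverseBranch (k : ℕ) (b : Fin 2) : Continuous (inverseBranch k b) := by
  unfold inverseBranch
  split_ifs <;> fun_prop

/-- Approximations of the ray with given digits. -/
def rayApprox : ℕ → ℕ → (ℕ → Fin 2) → ℝ
  | 0, _, _ => 0
  | N + 1, k, w => inverseBranch k (w 0) (rayApprox N (nextLevel k (w 0)) (shift w))

theorem rayApprox_mem (N k : ℕ) (w : ℕ → Fin 2) : rayApprox N k w ∈ Set.Icc (0 : ℝ) 1 := by
  induction N generalizing k w with
  | zero => simp [rayApprox]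
  | succ N ih => exact inverseBranch_mem (ih _ _)

/-- All inverse branches contract by at least `5`, whatever the level, so the approximations
converge geometrically. -/
theorem dist_rayApprox_succ_le (N k : ℕ) (w : ℕ → Fin 2) :
    dist (rayApprox N k w) (rayApprox (N + 1) k w) ≤ 1 * (1 / 5) ^ N := by
  induction N generalizing k w with
  | zero =>
    have := rayApprox_mem 1 k w
    rw [Real.dist_eq, abs_sub_comm, show rayApprox 0 k w = 0 from rfl, sub_zero,
      abs_of_nonneg this.1]
    simpa using this.2
  | succ N ih =>
    have h1 := ih (nextLevel k (w 0)) (shift w)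
    have h2 := abs_inverseBranch_sub_le k (w 0) (rayApprox N (nextLevel k (w 0)) (shift w))
      (rayApprox (N + 1) (nextLevel k (w 0)) (shift w))
    rw [Real.dist_eq] at h1 ⊢
    rw [pow_succ]
    refine h2.trans ?_
    linarith

theorem exists_tendsto_rayApprox (k : ℕ) (w : ℕ → Fin 2) :
    ∃ t, Tendsto (fun N => rayApprox N k w) atTop (𝓝 t) :=
  cauchySeq_tendsto_of_complete (cauchySeq_of_le_geometric (1 / 5) 1 (by norm_num)
    fun N => dist_rayApprox_succ_le N k w)

/-- The ray with given digits, at height `2⁻ᵏ`. -/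
def ray (k : ℕ) (w : ℕ → Fin 2) : ℝ := (exists_tendsto_rayApprox k w).choose

theorem tendsto_rayApprox (k : ℕ) (w : ℕ → Fin 2) :
    Tendsto (fun N => rayApprox N k w) atTop (𝓝 (ray k w)) :=
  (exists_tendsto_rayApprox k w).choose_spec

theorem ray_mem (k : ℕ) (w : ℕ → Fin 2) : ray k w ∈ Set.Icc (0 : ℝ) 1 :=
  isClosed_Icc.mem_of_tendsto (tendsto_rayApprox k w)
    (Eventually.of_forall fun N => rayApprox_mem N k w)

theorem ray_eq (k : ℕ) (w : ℕ → Fin 2) :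
    ray k w = inverseBranch k (w 0) (ray (nextLevel k (w 0)) (shift w)) :=
  tendsto_nhds_unique ((tendsto_rayApprox k w).comp (tendsto_add_atTop_nat 1))
    (((continuous_inverseBranch k (w 0)).tendsto _).comp (tendsto_rayApprox _ _))

theorem measurable_shift : Measurable shift :=
  measurable_pi_lambda _ fun i => measurable_pi_apply (i + 1)

theorem measurable_nextLevel : Measurable fun q : ℕ × Fin 2 => nextLevel q.1 q.2 :=
  Measurable.of_discrete

theorem measurable_rayApprox (N k : ℕ) : Measurable (rayApprox N k) := by
  induction N generalizing k with
  | zero => exact measurable_const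
  | succ N ih =>
    have h : ∀ b : Fin 2, Measurable fun w : ℕ → Fin 2 =>
        inverseBranch k b (rayApprox N (nextLevel k b) (shift w)) := fun b =>
      (continuous_inverseBranch k b).measurable.comp ((ih _).comp measurable_shift)
    have : rayApprox (N + 1) k = fun w => if w 0 = 0 then
        inverseBranch k 0 (rayApprox N (nextLevel k 0) (shift w)) else
        inverseBranch k 1 (rayApprox N (nextLevel k 1) (shift w)) := by
      funext w
      rw [rayApprox]
      split_ifs with h0
      · rw [h0]
      · rw [show w 0 = 1 by omega]
    rw [this]
    exact Measurable.ite (measurable_pi_apply 0 (measurableSet_singleton 0)) (h 0) (h 1)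

theorem measurable_ray (k : ℕ) : Measurable (ray k) :=
  measurable_of_tendsto_metrizable (fun N => measurable_rayApprox N k)
    (tendsto_pi_nhds.2 fun w => tendsto_rayApprox k w)

/-- The point at height `2⁻ᵏ` with digits `w`. -/
def codedPoint (q : ℕ × (ℕ → Fin 2)) : unitSquare :=
  ⟨((1 / 2) ^ q.1 * ray q.1 q.2, (1 / 2) ^ q.1), by
    have hy : (1 / 2 : ℝ) ^ q.1 ≤ 1 := pow_le_one₀ (by norm_num) (by norm_num)
    have hr := ray_mem q.1 q.2
    exact ⟨⟨mul_nonneg (by positivity) hr.1, mul_le_one₀ hy hr.1 hr.2⟩, ⟨by positivity, hy⟩⟩⟩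

theorem measurable_codedPoint : Measurable codedPoint := by
  have hray : Measurable fun q : ℕ × (ℕ → Fin 2) => ray q.1 q.2 :=
    measurable_from_prod_countable_right measurable_ray
  have hpow : Measurable fun q : ℕ × (ℕ → Fin 2) => (1 / 2 : ℝ) ^ q.1 :=
    (Measurable.of_discrete (f := fun k : ℕ => (1 / 2 : ℝ) ^ k)).comp measurable_fst
  exact Measurable.subtype_mk ((hpow.mul hray).prodMk hpow)

/-- The map on levels and digits which corresponds to `coneMap`. -/
def codeShift (q : ℕ × (ℕ → Fin 2)) : ℕ × (ℕ → Fin 2) := (nextLevel q.1 (q.2 0), shift q.2)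

/-- The inverse branches land in the disjoint intervals `[0, 1/5]` and `[4/5, 1]`, so the ray
reveals its first digit. -/
theorem digit_codedPoint (q : ℕ × (ℕ → Fin 2)) : digit (codedPoint q) = q.2 0 := by
  obtain ⟨k, w⟩ := q
  have hr := ray_mem (nextLevel k (w 0)) (shift w)
  have hy : (0 : ℝ) < (1 / 2) ^ k := by positivity
  have hlow : piece (codedPoint (k, w)) = .low ↔ 5 * ray k w ≤ 1 := by
    rw [piece_eq_low_iff]
    simp only [codedPoint]
    rw [show 5 * ((1 / 2 : ℝ) ^ k * ray k w) = (1 / 2) ^ k * (5 * ray k w) by ring,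
      mul_le_iff_le_one_right hy]
  have key : digit (codedPoint (k, w)) = 0 ↔ w 0 = 0 := by
    rw [digit_eq_zero_iff, hlow, ray_eq, inverseBranch]
    obtain ⟨h0, h1⟩ := hr
    split_ifs with hb hk
    · exact ⟨fun _ => hb, fun _ => by linarith⟩
    · exact ⟨fun h => by linarith, fun h => absurd h hb⟩
    · exact ⟨fun h => by linarith, fun h => absurd h hb⟩
  change digit (codedPoint (k, w)) = w 0
  omega

/-- Each inverse branch undoes the action on rays. Digit `1` at level `0` is the truncated case: the
height remains `1`, matching `0 - 1 = 0` in `nextLevel`, and the slope on rays is `-10` instead of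
`-5`. -/
theorem coneMap_codedPoint (q : ℕ × (ℕ → Fin 2)) :
    coneMap (codedPoint q) = codedPoint (codeShift q) := by
  obtain ⟨k, w⟩ := q
  obtain ⟨h0, h1⟩ := ray_mem (nextLevel k (w 0)) (shift w)
  have hy : (0 : ℝ) < (1 / 2) ^ k := by positivity
  have hy1 : (1 / 2 : ℝ) ^ k ≤ 1 := pow_le_one₀ (by norm_num) (by norm_num)
  refine Subtype.ext ?_
  rcases eq_or_ne (w 0) 0 with hw | hw
  · have hd : piece (codedPoint (k, w)) = .low := by
      rw [← digit_eq_zero_iff, digit_codedPoint]; exact hw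
    rw [coneMap_eq_branch, hd]
    simp only [branch, affineOfCoeffs_apply, codedPoint, codeShift]
    rw [ray_eq k w]
    simp only [hw, inverseBranch, nextLevel, if_true, pow_succ]
    refine Prod.ext ?_ ?_ <;> simp only <;> ring
  · have hr := ray_eq k w
    simp only [coneMap, mapFst, mapSnd, codedPoint, codeShift]
    rw [hr]
    generalize hu : ray (nextLevel k (w 0)) (shift w) = u at *
    rcases Nat.eq_zero_or_pos k with rfl | hk
    · simp only [inverseBranch, if_neg hw, if_true, nextLevel, Nat.zero_sub, pow_zero, one_mul]
      refine Prod.ext ?_ ?_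
      · simp only
        rw [min_eq_right, min_eq_left, max_eq_right]
        · ring
        · linarith
        · linarith
        · exact (min_le_right _ _).trans (by linarith)
      · simp only
        rw [max_eq_right, min_eq_right, min_eq_right]
        · norm_num
        · exact (min_le_right _ _).trans (by linarith)
        · linarith
    · obtain ⟨k, rfl⟩ : ∃ j, k = j + 1 := ⟨k - 1, by omega⟩
      have hz : (1 / 2 : ℝ) ^ k ≤ 1 := pow_le_one₀ (by norm_num) (by norm_num)
      have hz0 : (0 : ℝ) < (1 / 2) ^ k := by positivity
      simp only [inverseBranch, if_neg hw, if_neg (Nat.succ_ne_zero k), nextLevel,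
        Nat.add_sub_cancel, pow_succ]
      generalize (1 / 2 : ℝ) ^ k = z at *
      have hzu : z * u ≤ z := mul_le_of_le_one_right hz0.le h1
      have hzu0 : 0 ≤ z * u := mul_nonneg hz0.le h0
      refine Prod.ext ?_ ?_
      · simp only
        rw [min_eq_right, min_eq_left, max_eq_right]
        · ring
        · linarith
        · linarith
        · exact (min_le_left _ _).trans (by linarith)
      · simp only
        rw [max_eq_right, min_eq_right, min_eq_left]
        · ring
        · linarith
        · exact (min_le_left _ _).trans (by linarith)
        · linarith

theorem iterate_codedPoint (q : ℕ × (ℕ → Fin 2)) (n : ℕ) :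
    coneMap^[n] (codedPoint q) = codedPoint (codeShift^[n] q) := by
  induction n with
  | zero => rfl
  | succ n ih => rw [Function.iterate_succ_apply', Function.iterate_succ_apply', ih,
      coneMap_codedPoint]

theorem codeShift_iterate_snd (q : ℕ × (ℕ → Fin 2)) (n i : ℕ) :
    (codeShift^[n] q).2 i = q.2 (n + i) := by
  induction n generalizing i with
  | zero => simp
  | succ n ih =>
    rw [Function.iterate_succ_apply']
    simp only [codeShift, shift]
    rw [ih, Nat.add_assoc, Nat.add_comm 1 i]

theorem digit_iterate_codedPoint (q : ℕ × (ℕ → Fin 2)) (n : ℕ) :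
    digit (coneMap^[n] (codedPoint q)) = q.2 n := by
  rw [iterate_codedPoint, digit_codedPoint, codeShift_iterate_snd, add_zero]

/-! ### Invariant measures of large entropy -/

/-- The probability measure on digits with parameter `b`. -/
def digitMeasure (b : Fin 2 → ℝ) : Measure (Fin 2) :=
  ENNReal.ofReal (b 0) • Measure.dirac 0 + ENNReal.ofReal (b 1) • Measure.dirac 1

theorem digitMeasure_singleton (b : Fin 2 → ℝ) (i : Fin 2) :
    digitMeasure b {i} = ENNReal.ofReal (b i) := by
  fin_cases i <;> simp [digitMeasure]

theorem isProbabilityMeasure_digitMeasure {b : Fin 2 → ℝ} (hb : ∀ i, 0 ≤ b i)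
    (h1 : b 0 + b 1 = 1) : IsProbabilityMeasure (digitMeasure b) := by
  constructor
  simp [digitMeasure, ← ENNReal.ofReal_add (hb 0) (hb 1), h1]

section Shift

variable (β : Measure (Fin 2)) [IsProbabilityMeasure β]

/-- Prepend a digit to a sequence. -/
def consDigit (q : Fin 2 × (ℕ → Fin 2)) (i : ℕ) : Fin 2 := Nat.casesOn i q.1 q.2

theorem measurable_consDigit : Measurable consDigit := by
  refine measurable_pi_lambda _ fun i => ?_
  cases i with
  | zero => exact measurable_fst
  | succ i => exact (measurable_pi_apply i).comp measurable_snd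

theorem map_consDigit : (β.prod (Measure.infinitePi fun _ : ℕ => β)).map consDigit =
    Measure.infinitePi fun _ : ℕ => β := by
  classical
  refine Measure.eq_infinitePi _ fun s t ht => ?_
  obtain ⟨N, hN⟩ := s.exists_nat_subset_range
  let t' : ℕ → Set (Fin 2) := fun i => if i ∈ s then t i else Set.univ
  have hpre : consDigit ⁻¹' (Set.pi s t) =
      t' 0 ×ˢ Set.pi (Finset.range N) (fun i => t' (i + 1)) := by
    ext ⟨b, w⟩
    simp only [Set.mem_preimage, Set.mem_pi, Set.mem_prod, SetLike.mem_coe, Finset.mem_range]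
    constructor
    · intro h
      refine ⟨?_, fun i _ => ?_⟩
      · by_cases h0 : 0 ∈ s
        · simpa [t', consDigit, h0] using h 0 h0
        · simp [t', h0]
      · by_cases hi : i + 1 ∈ s
        · simpa [t', consDigit, hi] using h (i + 1) hi
        · simp [t', hi]
    · rintro ⟨h0, h⟩ i hi
      cases i with
      | zero => simpa [t', consDigit, hi] using h0
      | succ i =>
        have := h i (by have := Finset.mem_range.1 (hN hi); omega)
        simpa [t', consDigit, hi] using this
  rw [Measure.map_apply measurable_consDigit (MeasurableSet.pi s.countable_toSet fun i _ => ht i),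
    hpre, Measure.prod_prod, Measure.infinitePi_pi _ (fun i _ => MeasurableSet.of_discrete)]
  have h1 : ∏ i ∈ s, β (t i) = ∏ i ∈ Finset.range (N + 1), β (t' i) := by
    have hsub : s ⊆ Finset.range (N + 1) :=
      hN.trans (Finset.range_subset_range.2 N.le_succ)
    rw [← Finset.prod_subset hsub (f := fun i => β (t' i)) (fun i _ hi => by simp [t', hi])]
    exact Finset.prod_congr rfl fun i hi => by simp [t', hi]
  rw [h1, Finset.prod_range_succ', mul_comm]

theorem measurePreserving_split :
    MeasurePreserving (fun w : ℕ → Fin 2 => (w 0, shift w))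
      (Measure.infinitePi fun _ : ℕ => β) (β.prod (Measure.infinitePi fun _ : ℕ => β)) := by
  have hm : Measurable fun w : ℕ → Fin 2 => (w 0, shift w) :=
    (measurable_pi_apply 0).prodMk measurable_shift
  refine ⟨hm, ?_⟩
  conv_lhs => rw [← map_consDigit β]
  rw [Measure.map_map hm measurable_consDigit]
  exact Measure.map_id

/-- The next level uses only the level and the first digit, which are independent of the remaining
digits; these again have the product law. -/
theorem measurePreserving_codeShift (π : Measure ℕ) [IsProbabilityMeasure π]
    (hπ : MeasurePreserving (fun q : ℕ × Fin 2 => nextLevel q.1 q.2) (π.prod β) π) :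
    MeasurePreserving codeShift (π.prod (Measure.infinitePi fun _ : ℕ => β))
      (π.prod (Measure.infinitePi fun _ : ℕ => β)) := by
  have h1 := (MeasurePreserving.id π).prod (measurePreserving_split β)
  have h2 := (measurePreserving_prodAssoc π β (Measure.infinitePi fun _ : ℕ => β)).symm
    MeasurableEquiv.prodAssoc
  have h3 := hπ.prod (MeasurePreserving.id (Measure.infinitePi fun _ : ℕ => β))
  exact h3.comp (h2.comp h1)

end Shift

/-- The geometric distribution is stationary for the reflected random walk. -/
theorem measurePreserving_nextLevel {s : unitInterval} (hs : s ≠ 0) {b : Fin 2 → ℝ}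
    (hb : ∀ i, 0 ≤ b i) (h1 : b 0 + b 1 = 1) (hbs : b 0 = (1 - s) * b 1) :
    MeasurePreserving (fun q : ℕ × Fin 2 => nextLevel q.1 q.2)
      ((ProbabilityTheory.geometricMeasure s).prod (digitMeasure b))
      (ProbabilityTheory.geometricMeasure s) := by
  have := isProbabilityMeasure_digitMeasure hb h1
  refine ⟨measurable_nextLevel, ?_⟩
  refine Measure.ext_of_singleton fun n => ?_
  have hg0 := ProbabilityTheory.geometricMeasure_nonneg s
  have hprod : ∀ (k : ℕ) (i : Fin 2),
      ((ProbabilityTheory.geometricMeasure s).prod (digitMeasure b)) ({k} ×ˢ {i}) =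
        ENNReal.ofReal ((1 - s) ^ k * s * b i) := by
    intro k i
    rw [Measure.prod_prod, ProbabilityTheory.geometricMeasure_singleton hs,
      digitMeasure_singleton, ← ENNReal.ofReal_mul (hg0 k)]
  rw [Measure.map_apply measurable_nextLevel (measurableSet_singleton n),
    ProbabilityTheory.geometricMeasure_singleton hs]
  cases n with
  | zero =>
    have hpre : (fun q : ℕ × Fin 2 => nextLevel q.1 q.2) ⁻¹' {0} =
        -- Reflection: level `0` is reached by digit `1` from level `1` and from itself.
        ({0} ×ˢ {1}) ∪ ({1} ×ˢ {1}) := by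
      ext ⟨k, i⟩
      fin_cases i <;> simp [nextLevel]
      omega
    rw [hpre, measure_union _ MeasurableSet.of_discrete, hprod, hprod,
      ← ENNReal.ofReal_add (mul_nonneg (hg0 0) (hb 1)) (mul_nonneg (hg0 1) (hb 1))]
    · congr 1
      have : b 1 * (1 + (1 - s)) = 1 := by linarith
      linear_combination (s : ℝ) * this
    · simp
  | succ n =>
    have hpre : (fun q : ℕ × Fin 2 => nextLevel q.1 q.2) ⁻¹' {n + 1} =
        ({n} ×ˢ {0}) ∪ ({n + 2} ×ˢ {1}) := by
      ext ⟨k, i⟩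
      simp only [nextLevel, Set.mem_preimage, Set.mem_singleton_iff, Set.mem_union, Set.mem_prod]
      split_ifs <;> omega
    rw [hpre, measure_union _ MeasurableSet.of_discrete, hprod, hprod,
      ← ENNReal.ofReal_add (mul_nonneg (hg0 _) (hb 0)) (mul_nonneg (hg0 _) (hb 1))]
    · congr 1
      have : b 1 * (1 + (1 - s)) = 1 := by linarith
      rw [hbs]
      linear_combination (s : ℝ) * (1 - s) ^ (n + 1) * this
    · simp

theorem sum_prod_word (b : Fin 2 → ℝ) (h1 : b 0 + b 1 = 1) (n : ℕ) :
    ∑ v : Fin n → Fin 2, ∏ i, b (v i) = 1 := by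
  rw [← Fintype.piFinset_univ, Finset.sum_prod_piFinset]
  simp [h1]

/-- Entropy of independent digits is additive; split off one digit with `Real.negMulLog_mul`. -/
theorem sum_negMulLog_prod_word (b : Fin 2 → ℝ) (h1 : b 0 + b 1 = 1) (n : ℕ) :
    ∑ v : Fin n → Fin 2, Real.negMulLog (∏ i, b (v i)) =
      n * (Real.negMulLog (b 0) + Real.negMulLog (b 1)) := by
  induction n with
  | zero => simp
  | succ n ih =>
    rw [← (Fin.consEquiv fun _ : Fin (n + 1) => Fin 2).sum_comp, Fintype.sum_prod_type]
    simp only [Fin.consEquiv_apply, Fin.prod_univ_succ, Fin.cons_zero, Fin.cons_succ,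
      Real.negMulLog_mul, Finset.sum_add_distrib, ← Finset.mul_sum, ← Finset.sum_mul,
      sum_prod_word b h1, ih, Fin.sum_univ_two, h1]
    push_cast
    ring

/-- The invariant measure with independent digits, whose heights are given by the stationary
distribution of the reflected random walk. -/
def walkMeasure (s : unitInterval) (b : Fin 2 → ℝ) : Measure unitSquare :=
  ((ProbabilityTheory.geometricMeasure s).prod
    (Measure.infinitePi fun _ : ℕ => digitMeasure b)).map codedPoint

section Walk

variable {s : unitInterval} (hs : s ≠ 0) {b : Fin 2 → ℝ} (hb : ∀ i, 0 ≤ b i)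
  (h1 : b 0 + b 1 = 1) (hbs : b 0 = (1 - s) * b 1)

include hb h1

theorem partitionEntropy_walkMeasure (n : ℕ) :
    partitionEntropy (walkMeasure s b) (joinedPartition coneMap digit n) =
      n * (Real.negMulLog (b 0) + Real.negMulLog (b 1)) := by
  classical
  have := isProbabilityMeasure_digitMeasure hb h1
  rw [← sum_negMulLog_prod_word b h1 n]
  refine Finset.sum_congr rfl fun v _ => ?_
  congr 1
  have hpre : codedPoint ⁻¹' (joinedPartition coneMap digit n ⁻¹' {v}) =
      Set.univ ×ˢ Set.pi (Finset.range n)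
        (fun i => if h : i < n then {v ⟨i, h⟩} else (Set.univ : Set (Fin 2))) := by
    ext q
    simp only [Set.mem_preimage, Set.mem_singleton_iff, Set.mem_prod, Set.mem_univ, true_and,
      Set.mem_pi, SetLike.mem_coe, Finset.mem_range]
    constructor
    · intro h i hi
      rw [dif_pos hi, ← h]
      exact (digit_iterate_codedPoint q i).symm
    · intro h
      funext i
      have := h i i.2
      rw [dif_pos i.2] at this
      exact (digit_iterate_codedPoint q i).trans this
  rw [walkMeasure, measureReal_def, Measure.map_apply measurable_codedPoint
    (measurable_joinedPartition continuous_coneMap.measurable measurable_digit n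
      (measurableSet_singleton v)), hpre, Measure.prod_prod, measure_univ, one_mul,
    Measure.infinitePi_pi _ (fun i _ => MeasurableSet.of_discrete), ENNReal.toReal_prod,
    Finset.prod_range]
  refine Finset.prod_congr rfl fun i _ => ?_
  rw [dif_pos i.2, digitMeasure_singleton, ENNReal.toReal_ofReal (hb _)]

theorem le_metricEntropy_walkMeasure :
    ((Real.negMulLog (b 0) + Real.negMulLog (b 1) : ℝ) : EReal) ≤
      metricEntropy coneMap (walkMeasure s b) := by
  have h : entropyOfPartition coneMap (walkMeasure s b) digit =
      ((Real.negMulLog (b 0) + Real.negMulLog (b 1) : ℝ) : EReal) := by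
    unfold entropyOfPartition
    refine Tendsto.limsup_eq (tendsto_const_nhds.congr' ?_)
    filter_upwards [eventually_gt_atTop 0] with n hn
    have hn' : (n : ℝ) ≠ 0 := by positivity
    rw [partitionEntropy_walkMeasure hb h1, mul_div_cancel_left₀ _ hn']
  rw [← h]
  exact le_iSup_of_le 2 (le_iSup_of_le digit (le_iSup_of_le measurable_digit le_rfl))

include hs hbs

theorem isInvariantProbability_walkMeasure :
    IsInvariantProbability coneMap (walkMeasure s b) := by
  have := isProbabilityMeasure_digitMeasure hb h1
  refine ⟨Measure.isProbabilityMeasure_map measurable_codedPoint.aemeasurable,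
    continuous_coneMap.measurable, ?_⟩
  have hF := measurePreserving_codeShift (digitMeasure b) (ProbabilityTheory.geometricMeasure s)
    (measurePreserving_nextLevel hs hb h1 hbs)
  rw [walkMeasure, Measure.map_map continuous_coneMap.measurable measurable_codedPoint]
  conv_rhs => rw [← hF.map_eq]
  rw [Measure.map_map measurable_codedPoint hF.measurable]
  congr 1
  funext q
  exact coneMap_codedPoint q

end Walk

theorem exists_log_two_sub_le_metricEntropy {ε : ℝ} (hε : 0 < ε) :
    ∃ μ, IsInvariantProbability coneMap μ ∧
      ((Real.log 2 - ε : ℝ) : EReal) ≤ metricEntropy coneMap μ := by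
  have hcont : ContinuousAt (fun s : ℝ => Real.binEntropy (1 / (2 - s))) 0 := by
    refine Real.binEntropy_continuous.continuousAt.comp ?_
    exact ContinuousAt.div (by fun_prop) (by fun_prop) (by norm_num)
  have hval : Real.log 2 - ε < Real.binEntropy (1 / (2 - 0)) := by
    rw [sub_zero, one_div, Real.binEntropy_two_inv]
    linarith
  obtain ⟨δ, hδ, hball⟩ := Metric.eventually_nhds_iff.1 (hcont.eventually (lt_mem_nhds hval))
  obtain ⟨s, hs0, hs⟩ := exists_between (lt_min hδ one_pos)
  have hsδ := hs.trans_le (min_le_left _ _)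
  have hs1 := hs.trans_le (min_le_right _ _)
  let s' : unitInterval := ⟨s, hs0.le, hs1.le⟩
  have h2s : 2 - s ≠ 0 := by linarith
  -- The solution of `b 0 + b 1 = 1` and the balance equation `b 0 = (1 - s) * b 1`. As `s → 0` it
  -- tends to the fair coin, whose entropy is `log 2`.
  let b : Fin 2 → ℝ := ![1 - 1 / (2 - s), 1 / (2 - s)]
  have hb0 : b 0 = 1 - 1 / (2 - s) := rfl
  have hb1 : b 1 = 1 / (2 - s) := rfl
  have hb : ∀ i, 0 ≤ b i := by
    rw [Fin.forall_fin_two, hb0, hb1]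
    refine ⟨?_, div_nonneg zero_le_one (by linarith)⟩
    rw [sub_nonneg, div_le_one (by linarith)]
    linarith
  have hsum : b 0 + b 1 = 1 := by rw [hb0, hb1]; ring
  have hbs : b 0 = (1 - (s' : ℝ)) * b 1 := by
    rw [hb0, hb1]
    change 1 - 1 / (2 - s) = (1 - s) * (1 / (2 - s))
    field_simp
    ring
  refine ⟨walkMeasure s' b, isInvariantProbability_walkMeasure
    (fun h => hs0.ne' (congrArg Subtype.val h)) hb hsum hbs,
    le_trans ?_ (le_metricEntropy_walkMeasure hb hsum)⟩
  rw [EReal.coe_le_coe_iff, hb0, hb1, add_comm,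
    ← Real.binEntropy_eq_negMulLog_add_negMulLog_one_sub]
  refine (hball ?_).le
  rw [Real.dist_eq, sub_zero, abs_of_pos hs0]
  exact hsδ

/-! ### Topological entropy -/

theorem log_natCast_div {c : ℕ} (hc : 0 < c) (n : ℕ) :
    ENNReal.log (((c : ℕ∞) : ENNReal)) / n = ((Real.log c / n : ℝ) : EReal) := by
  have h : (((c : ℕ∞) : ENNReal)) = ENNReal.ofReal c := by simp
  rw [h, ENNReal.log_ofReal_of_pos (Nat.cast_pos.2 hc), EReal.coe_div]
  rfl

/-- Choose one point for every realized pair of digit word and code. Points with the same pair share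
their grid name, hence stay within `1 / m` of each other for `n` steps. -/
theorem coverMincard_coneMap_le {m : ℕ} (hm : 0 < m) {U : SetRel unitSquare unitSquare}
    (hU : ∀ p q : unitSquare, dist p q < 1 / m → (p, q) ∈ U) (n : ℕ) :
    Dynamics.coverMincard coneMap Set.univ U n ≤
      ((2 ^ n * Fintype.card (Code m n) : ℕ) : ℕ∞) := by
  classical
  have : Nonempty unitSquare := ⟨⟨(0, 0), by simp⟩⟩
  obtain ⟨e, -, he⟩ := exists_code m n
  let name : unitSquare → (Fin n → Fin 2) × Code m n :=
    fun p => (joinedPartition coneMap digit n p, e p)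
  have hfin : (Set.range name).Finite := Set.toFinite _
  let s : Finset unitSquare := hfin.toFinset.image (Function.invFun name)
  have hs : Dynamics.IsDynCoverOf coneMap Set.univ U n s := by
    intro p _
    have hp : name (Function.invFun name (name p)) = name p := Function.invFun_eq ⟨p, rfl⟩
    refine ⟨Function.invFun name (name p), ?_, ?_⟩
    · simp only [s, Finset.coe_image, Set.Finite.coe_toFinset]
      exact ⟨name p, ⟨p, rfl⟩, rfl⟩
    · rw [Dynamics.mem_dynEntourage]
      intro i hi
      have h1 := congrArg Prod.fst hp
      have h2 := congrArg Prod.snd hp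
      have h3 := congrFun (he _ _ h1 h2) ⟨i, hi⟩
      exact hU _ _ (dist_lt_of_gridCell_eq hm h3.symm)
  refine hs.coverMincard_le_card.trans ?_
  have hcard : s.card ≤ 2 ^ n * Fintype.card (Code m n) := by
    refine Finset.card_image_le.trans ((Finset.card_le_univ _).trans ?_)
    simp
  exact_mod_cast hcard

theorem topologicalEntropy_coneMap_le :
    topologicalEntropy coneMap ≤ ((Real.log 2 : ℝ) : EReal) := by
  refine iSup₂_le fun U hU => ?_
  obtain ⟨ε, hε, hεU⟩ := Metric.mem_uniformity_dist.1 hU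
  obtain ⟨m, hm⟩ := exists_nat_one_div_lt hε
  have hcover := coverMincard_coneMap_le (U := U) m.succ_pos
    (fun p q h => hεU (h.trans (by simpa using hm)))
  have hlim : Tendsto (fun n : ℕ => ((Real.log 2 +
      Real.log (Fintype.card (Code (m + 1) n)) / n : ℝ) : EReal)) atTop
      (𝓝 ((Real.log 2 : ℝ) : EReal)) := by
    refine (continuous_coe_real_ereal.tendsto _).comp ?_
    simpa using (tendsto_log_card_code_div (m + 1)).const_add (Real.log 2)
  rw [← hlim.limsup_eq]
  refine limsup_le_limsup ?_
  filter_upwards [eventually_gt_atTop 0] with n hn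
  have hn' : (n : ℝ) ≠ 0 := by positivity
  have hpos : 0 < Fintype.card (Code (m + 1) n) := by rw [card_code]; positivity
  have h1 : Real.log 2 + Real.log (Fintype.card (Code (m + 1) n)) / n =
      Real.log ((2 ^ n * Fintype.card (Code (m + 1) n) : ℕ) : ℝ) / n := by
    push_cast
    rw [Real.log_mul (by positivity) (by positivity), Real.log_pow]
    field_simp
  rw [h1, ← log_natCast_div (by positivity)]
  refine EReal.monotone_div_right_of_nonneg n.cast_nonneg' (ENNReal.log_monotone ?_)
  exact ENat.toENNReal_mono (hcover n)

/-! ### Lower bound for the topological entropy: separated orbits -/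

/-- Either the walk was reflected at `0` and has since risen by at most the elapsed time, or it was
never reflected and its level is given exactly by the digit count. -/
theorem level_le (k : ℕ) (w : ℕ → Fin 2) (r : ℕ) :
    (codeShift^[r] (k, w)).1 ≤ r ∨
      (codeShift^[r] (k, w)).1 + 2 * ((Finset.range r).filter fun i => w i = 1).card ≤ k + r := by
  induction r with
  | zero => right; simp
  | succ r ih =>
    rw [Function.iterate_succ_apply', Finset.range_add_one, Finset.filter_insert]
    simp only [codeShift, nextLevel]
    rw [codeShift_iterate_snd, add_zero]
    simp only
    by_cases hw : w r = 0
    · rw [if_pos hw, if_neg (by omega)]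
      omega
    · rw [if_neg hw, if_pos (by omega), Finset.card_insert_of_notMem (by simp)]
      omega

theorem level_succ_le (q : ℕ × (ℕ → Fin 2)) (r : ℕ) :
    (codeShift^[r] q).1 ≤ q.1 + r := by
  induction r with
  | zero => simp
  | succ r ih =>
    rw [Function.iterate_succ_apply']
    simp only [codeShift, nextLevel]
    split_ifs <;> omega

theorem level_congr {k : ℕ} {w w' : ℕ → Fin 2} {n : ℕ} (h : ∀ i < n, w i = w' i) :
    (codeShift^[n] (k, w)).1 = (codeShift^[n] (k, w')).1 := by
  induction n with
  | zero => rfl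
  | succ n ih =>
    rw [Function.iterate_succ_apply', Function.iterate_succ_apply']
    simp only [codeShift]
    rw [codeShift_iterate_snd, codeShift_iterate_snd, ih fun i hi => h i (hi.trans n.lt_succ_self)]
    simp only [add_zero]
    rw [h n n.lt_succ_self]

/-- At the same height, first digits differing puts the rays in `[0, 1/5]` and `[4/5, 1]`, which are
`3/5` apart. -/
theorem le_dist_codedPoint {k : ℕ} {w w' : ℕ → Fin 2} (h : w 0 ≠ w' 0) :
    3 / 5 * (1 / 2 : ℝ) ^ k ≤ dist (codedPoint (k, w)) (codedPoint (k, w')) := by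
  wlog h0 : w 0 = 0 generalizing w w' with H
  · rw [dist_comm]
    exact H h.symm (by omega)
  have h1 : w' 0 ≠ 0 := fun h' => h (h0.trans h'.symm)
  have hr := ray_mem (nextLevel k (w 0)) (shift w)
  have hr' := ray_mem (nextLevel k (w' 0)) (shift w')
  have ht : ray k w ≤ 1 / 5 := by
    rw [ray_eq, inverseBranch, if_pos h0]
    linarith [hr.2]
  have ht' : 4 / 5 ≤ ray k w' := by
    rw [ray_eq, inverseBranch, if_neg h1]
    split_ifs <;> linarith [hr'.2]
  have hy : (0 : ℝ) < (1 / 2) ^ k := by positivity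
  refine le_trans ?_ (le_max_left _ _)
  simp only [codedPoint]
  rw [dist_comm, Real.dist_eq, ← mul_sub, abs_of_nonneg (mul_nonneg hy.le (by linarith)), mul_comm]
  exact mul_le_mul_of_nonneg_left (by linarith) hy.le

/-- The words of length `L` in which at least half of the digits are ones. -/
def heavyBlocks (L : ℕ) : Finset (Finset (Fin L)) := Finset.univ.filter fun s => L ≤ 2 * s.card

theorem two_pow_le_card_heavyBlocks (L : ℕ) : 2 ^ L ≤ 2 * (heavyBlocks L).card := by
  classical
  have huniv : (Finset.univ : Finset (Finset (Fin L))) ⊆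
      heavyBlocks L ∪ (heavyBlocks L).image fun s => sᶜ := by
    intro s _
    have hs := s.card_le_univ
    rw [Fintype.card_fin] at hs
    simp only [heavyBlocks, Finset.mem_union, Finset.mem_filter, Finset.mem_univ, true_and,
      Finset.mem_image]
    by_cases h : L ≤ 2 * s.card
    · exact Or.inl h
    · refine Or.inr ⟨sᶜ, ?_, compl_compl s⟩
      rw [Finset.card_compl, Fintype.card_fin]
      omega
  have h := (Finset.card_le_card huniv).trans ((Finset.card_union_le _ _).trans
    (Nat.add_le_add_left Finset.card_image_le _))
  rw [Finset.card_univ, Fintype.card_finset, Fintype.card_fin] at h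
  omega

/-- The concatenation of `N` blocks of length `L`, followed by ones. -/
def concatBlocks {L N : ℕ} (c : Fin N → Finset (Fin L)) (i : ℕ) : Fin 2 :=
  if h : 0 < L ∧ i / L < N then wordOfFinset (c ⟨i / L, h.2⟩) ⟨i % L, Nat.mod_lt _ h.1⟩ else 1

theorem concatBlocks_apply {L N : ℕ} (c : Fin N → Finset (Fin L)) (j : Fin N) (r : Fin L) :
    concatBlocks c (j * L + r) = wordOfFinset (c j) r := by
  have hL : 0 < L := Fin.pos r
  have h1 : ((j : ℕ) * L + r) / L = j := by
    rw [mul_comm, Nat.mul_add_div hL, Nat.div_eq_of_lt r.2, add_zero]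
  have h2 : ((j : ℕ) * L + r) % L = r := by
    rw [mul_comm, Nat.mul_add_mod, Nat.mod_eq_of_lt r.2]
  rw [concatBlocks, dif_pos ⟨hL, by rw [h1]; exact j.2⟩]
  simp only [h1, h2]

/-- Over a heavy block, an unreflected walk does not end higher than it began, and a reflected one
ends at level at most `L`. -/
theorem level_concatBlocks_mul_le {L N : ℕ} {c : Fin N → Finset (Fin L)}
    (hc : ∀ j, c j ∈ heavyBlocks L) (j : ℕ) (hj : j ≤ N) :
    (codeShift^[j * L] (0, concatBlocks c)).1 ≤ L := by
  induction j with
  | zero => simp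
  | succ j ih =>
    have hjN : j < N := hj
    set q := codeShift^[j * L] (0, concatBlocks c) with hq
    have hq2 : ∀ r : Fin L, q.2 r = wordOfFinset (c ⟨j, hjN⟩) r := by
      intro r
      rw [hq, codeShift_iterate_snd]
      exact concatBlocks_apply c ⟨j, hjN⟩ r
    have hcard : ((Finset.range L).filter fun i => q.2 i = 1).card = (c ⟨j, hjN⟩).card := by
      have : ((Finset.range L).filter fun i => q.2 i = 1) =
          (c ⟨j, hjN⟩).map Fin.valEmbedding := by
        ext i
        simp only [Finset.mem_filter, Finset.mem_range, Finset.mem_map, Fin.valEmbedding_apply]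
        constructor
        · rintro ⟨hi, hd⟩
          refine ⟨⟨i, hi⟩, ?_, rfl⟩
          have := hq2 ⟨i, hi⟩
          rw [hd, wordOfFinset] at this
          by_contra hs
          simp [hs] at this
        · rintro ⟨r, hr, rfl⟩
          exact ⟨r.2, by rw [hq2, wordOfFinset, if_pos hr]⟩
      rw [this, Finset.card_map]
    have hheavy : L ≤ 2 * (c ⟨j, hjN⟩).card := (Finset.mem_filter.1 (hc _)).2
    have ih' : q.1 ≤ L := ih hjN.le
    rw [Nat.succ_mul, Nat.add_comm, Function.iterate_add_apply, ← hq]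
    have := level_le q.1 q.2 L
    rw [hcard, Prod.mk.eta] at this
    omega

theorem level_concatBlocks_le {L N : ℕ} {c : Fin N → Finset (Fin L)}
    (hc : ∀ j, c j ∈ heavyBlocks L) {i : ℕ} (hi : i < N * L) :
    (codeShift^[i] (0, concatBlocks c)).1 ≤ 2 * L := by
  have hL : 0 < L := Nat.pos_of_ne_zero fun h => by simp [h] at hi
  have hdiv : i / L < N := (Nat.div_lt_iff_lt_mul hL).2 hi
  have h1 := level_concatBlocks_mul_le hc (i / L) hdiv.le
  have h2 := level_succ_le (codeShift^[i / L * L] (0, concatBlocks c)) (i % L)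
  have h3 := Nat.mod_lt i hL
  rw [← Function.iterate_add_apply, Nat.add_comm, Nat.div_add_mod'] at h2
  omega

/-- At the first differing digit the two levels still agree. Levels are at most `L` at block ends,
hence at most `2L` throughout, so the two points are at a height where different digits are visible.
-/
theorem exists_le_dist_iterate_concatBlocks {L N : ℕ} {c c' : Fin N → Finset (Fin L)}
    (hc : ∀ j, c j ∈ heavyBlocks L) (hne : c ≠ c') :
    ∃ i < N * L, 3 / 5 * (1 / 2 : ℝ) ^ (2 * L) ≤
      dist (coneMap^[i] (codedPoint (0, concatBlocks c)))
        (coneMap^[i] (codedPoint (0, concatBlocks c'))) := by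
  classical
  have hex : ∃ i, i < N * L ∧ concatBlocks c i ≠ concatBlocks c' i := by
    by_contra hnot
    push Not at hnot
    refine hne (funext fun j => wordOfFinset_injective (funext fun r => ?_))
    rw [← concatBlocks_apply, ← concatBlocks_apply]
    refine hnot _ ?_
    calc (j : ℕ) * L + r < j * L + L := Nat.add_lt_add_left r.2 _
      _ = (j + 1) * L := (Nat.succ_mul _ _).symm
      _ ≤ N * L := Nat.mul_le_mul_right _ j.2
  obtain ⟨hi, hdiff⟩ := Nat.find_spec hex
  have hmin : ∀ k < Nat.find hex, concatBlocks c k = concatBlocks c' k := fun k hk => by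
    by_contra hne'
    exact Nat.find_min hex hk ⟨hk.trans hi, hne'⟩
  set i := Nat.find hex
  refine ⟨i, hi, ?_⟩
  rw [iterate_codedPoint, iterate_codedPoint]
  have hlev := level_congr (k := 0) hmin
  have hle := level_concatBlocks_le hc hi
  have hdig : (codeShift^[i] (0, concatBlocks c)).2 0 ≠
      (codeShift^[i] (0, concatBlocks c')).2 0 := by
    rw [codeShift_iterate_snd, codeShift_iterate_snd]
    exact hdiff
  have hdist := le_dist_codedPoint (k := (codeShift^[i] (0, concatBlocks c)).1) hdig
  rw [Prod.mk.eta, hlev, Prod.mk.eta, ← hlev] at hdist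
  refine le_trans ?_ hdist
  exact mul_le_mul_of_nonneg_left (pow_le_pow_of_le_one (by norm_num) (by norm_num) hle)
    (by norm_num)

theorem card_heavyBlocks_pow_le_netMaxcard (L N : ℕ) :
    (((heavyBlocks L).card ^ N : ℕ) : ℕ∞) ≤ Dynamics.netMaxcard coneMap Set.univ
      -- Half the separation `3/5`, because a dynamical net requires disjoint balls.
      {pq : unitSquare × unitSquare | dist pq.1 pq.2 < 3 / 10 * (1 / 2 : ℝ) ^ (2 * L)} (N * L) := by
  classical
  let A : Finset (Fin N → Finset (Fin L)) := Fintype.piFinset fun _ => heavyBlocks L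
  have hpos : (0 : ℝ) < (1 / 2) ^ (2 * L) := by positivity
  have hA : ∀ c ∈ A, ∀ j, c j ∈ heavyBlocks L := fun c hc => Fintype.mem_piFinset.1 hc
  let f : (Fin N → Finset (Fin L)) → unitSquare := fun c => codedPoint (0, concatBlocks c)
  have hinj : Set.InjOn f A := by
    intro c hc c' _ hcc'
    by_contra hne
    obtain ⟨i, -, hi⟩ := exists_le_dist_iterate_concatBlocks (hA c hc) hne
    change _ ≤ dist (coneMap^[i] (f c)) (coneMap^[i] (f c')) at hi
    rw [hcc', dist_self] at hi
    linarith
  have hnet : Dynamics.IsDynNetIn coneMap Set.univ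
      {pq : unitSquare × unitSquare | dist pq.1 pq.2 < 3 / 10 * (1 / 2 : ℝ) ^ (2 * L)} (N * L)
      (A.image f : Finset unitSquare) := by
    refine ⟨Set.subset_univ _, ?_⟩
    rw [Finset.coe_image]
    rintro _ ⟨c, hc, rfl⟩ _ ⟨c', hc', rfl⟩ hne
    refine Set.disjoint_left.2 fun z hz hz' => ?_
    obtain ⟨i, hi, hdist⟩ := exists_le_dist_iterate_concatBlocks (hA c hc)
      (fun h => hne (congrArg f h))
    have h1 := Dynamics.mem_ball_dynEntourage.1 hz i hi
    have h2 := Dynamics.mem_ball_dynEntourage.1 hz' i hi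
    change dist (coneMap^[i] (f c)) (coneMap^[i] z) < _ at h1
    change dist (coneMap^[i] (f c')) (coneMap^[i] z) < _ at h2
    have h3 := dist_triangle_right (coneMap^[i] (f c)) (coneMap^[i] (f c')) (coneMap^[i] z)
    change _ ≤ dist (coneMap^[i] (f c)) (coneMap^[i] (f c')) at hdist
    linarith
  have h := hnet.card_le_netMaxcard
  rw [Finset.card_image_of_injOn hinj, Fintype.card_piFinset] at h
  simpa using h

theorem le_topologicalEntropy_coneMap :
    ((Real.log 2 : ℝ) : EReal) ≤ topologicalEntropy coneMap := by
  have hL : ∀ L : ℕ, 0 < L → ((Real.log 2 - Real.log 2 / L : ℝ) : EReal) ≤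
      topologicalEntropy coneMap := by
    intro L hL
    set U := {pq : unitSquare × unitSquare | dist pq.1 pq.2 < 3 / 10 * (1 / 2 : ℝ) ^ (2 * L)}
      with hU
    have hUmem : U ∈ 𝓤 unitSquare := Metric.dist_mem_uniformity (by positivity)
    refine le_trans ?_ (Dynamics.netEntropyEntourage_le_coverEntropy coneMap Set.univ hUmem)
    refine le_limsup_of_frequently_le ?_ (by isBoundedDefault)
    -- The upper limit only needs the times that are multiples of `L`. There, at least `2 ^ (L - 1)`
    -- choices per block give growth rate at least `log 2 - log 2 / L`.
    refine frequently_atTop.2 fun N => ⟨(N + 1) * L, ?_, ?_⟩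
    · calc N ≤ N + 1 := N.le_succ
        _ ≤ (N + 1) * L := Nat.le_mul_of_pos_right _ hL
    · have hcard := two_pow_le_card_heavyBlocks L
      have hpos : 0 < (heavyBlocks L).card := by
        have : 0 < 2 ^ L := by positivity
        omega
      have hlog : L * Real.log 2 ≤ Real.log 2 + Real.log (heavyBlocks L).card := by
        rw [← Real.log_mul two_ne_zero (by positivity), ← Real.log_pow]
        exact Real.log_le_log (by positivity) (by exact_mod_cast hcard)
      have h1 : Real.log 2 - Real.log 2 / L ≤
          Real.log (((heavyBlocks L).card ^ (N + 1) : ℕ) : ℝ) / ((N + 1) * L : ℕ) := by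
        have hL' : (0 : ℝ) < L := Nat.cast_pos.2 hL
        push_cast
        rw [Real.log_pow]
        push_cast
        rw [mul_div_mul_left _ _ (by positivity), sub_le_iff_le_add, ← add_div, le_div_iff₀ hL']
        linarith
      refine (EReal.coe_le_coe_iff.2 h1).trans ?_
      rw [← log_natCast_div (by positivity)]
      refine EReal.monotone_div_right_of_nonneg (Nat.cast_nonneg' _) (ENNReal.log_monotone ?_)
      exact ENat.toENNReal_mono (card_heavyBlocks_pow_le_netMaxcard L (N + 1))
  have hlim : Tendsto (fun L : ℕ => ((Real.log 2 - Real.log 2 / L : ℝ) : EReal)) atTop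
      (𝓝 ((Real.log 2 : ℝ) : EReal)) := by
    refine (continuous_coe_real_ereal.tendsto _).comp ?_
    simpa using (tendsto_const_div_atTop_nhds_zero_nat (Real.log 2)).const_sub (Real.log 2)
  refine le_of_tendsto hlim ?_
  filter_upwards [eventually_gt_atTop 0] with L h using hL L h

theorem topologicalEntropy_coneMap :
    topologicalEntropy coneMap = ((Real.log 2 : ℝ) : EReal) :=
  le_antisymm topologicalEntropy_coneMap_le le_topologicalEntropy_coneMap

end

theorem mainTheorem1 :
    ∃ T : unitSquare → unitSquare, Continuous T ∧ IsPiecewiseAffine T ∧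
      topologicalEntropy T = ((Real.log 2 : ℝ) : EReal) ∧
      sSup {h : EReal | ∃ μ : Measure unitSquare,
        IsInvariantProbability T μ ∧ h = metricEntropy T μ} = ((Real.log 2 : ℝ) : EReal) ∧
      ¬ ∃ μ : Measure unitSquare, IsMaximalEntropyMeasure T μ := by
  refine ⟨coneMap, continuous_coneMap, isPiecewiseAffine_coneMap, topologicalEntropy_coneMap,
    le_antisymm ?_ ?_, ?_⟩
  · refine sSup_le ?_
    rintro _ ⟨μ, hμ, rfl⟩
    exact metricEntropy_le_log_two hμ
  · refine EReal.ge_of_forall_gt_iff_ge.1 fun z hz => ?_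
    rw [EReal.coe_lt_coe_iff] at hz
    obtain ⟨μ, hμ, hle⟩ := exists_log_two_sub_le_metricEntropy (ε := Real.log 2 - z) (by linarith)
    rw [sub_sub_cancel] at hle
    exact hle.trans (le_sSup ⟨μ, hμ, rfl⟩)
  · rintro ⟨μ, hμ, hmax⟩
    refine not_log_two_le_metricEntropy hμ ?_
    rw [hmax, topologicalEntropy_coneMap]
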